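/- Let $\Theta\subset\mathbb R^q$ be an open bounded convex set with closure $\Theta^c$, let $\theta\in\Theta$, and let $a:[0,\infty)\times\Theta^c\to\mathbb R$ be continuous with $a(t,\cdot)\in C^1(\Theta)$ for every $t\ge 0$. Let $\varepsilon=\{\varepsilon(t),\,t\in\mathbb R\}$ be a real stochastic process on a probability space $(\Omega,\mathfrak F,P)$, and suppose that $X(t)=a(t,\theta)+\varepsilon(t)$, $t\ge0$, is observed. A least squares estimator from the observations on $[0,T]$ is a random vector $\theta_T$ with values in $\Theta^c$ such that, almost surely, $Q_T(\theta_T)=\inf_{\tau\in\Theta^c}Q_T(\tau)$, where $Q_T(\tau)=\int_0^T[X(t)-a(t,\tau)]^2\,dt$. Assume: (N1) $\varepsilon$ is mean-square continuous and almost surely continuous, and $E\varepsilon(t)=0$ for all $t$. (N2(i)) $\varepsilon$ is jointly strictly sub-Gaussian: for all $n\ge1$, $t_1,\dots,t_n\in\mathbb R$ and $\Delta_1,\dots,\Delta_n\in\mathbb R$, $$E\exp\Bigl\{\sum_{i=1}^n\varepsilon(t_i)\Delta_i\Bigr\}\le\exp\Bigl\{\tfrac12\sum_{i,j=1}^n E[\varepsilon(t_i)\varepsilon(t_j)]\,\Delta_i\Delta_j\Bigr\}.$$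 (N3) $\varepsilon$ is (wide-sense) stationary with covariance function $B(t)=E\varepsilon(0)\varepsilon(t)=\int_{-\infty}^{\infty}e^{i\lambda t}f(\lambda)\,d\lambda$, where the spectral density $f\ge0$ is integrable and bounded, $f_0=\sup_{\lambda\in\mathbb R}f(\lambda)<\infty$. (R3) There are $T_0\ge0$, diagonal matrices $s_T=\mathrm{diag}(s_{1T},\dots,s_{qT})$, $T>T_0$, and constants $0<\underline c_i<\overline c_i<\infty$ such that $\underline c_i<s_{iT}^{-1}d_{iT}(\tau)<\overline c_i$ for all $\tau\in\Theta$, $T>T_0$ and $i=1,\dots,q$, where $d_{iT}(\tau)=\bigl(\int_0^T(\partial a(t,\tau)/\partial\tau_i)^2dt\bigr)^{1/2}$; and there are numbers $0<c_0<c_1<\infty$ such that for all $T>T_0$ and all $u,v\in U_T(\theta)=s_T(\Theta^c-\theta)$ $$c_0\|u-v\|^2\le\int_0^T\bigl(a(t,\theta+s_T^{-1}u)-a(t,\theta+s_T^{-1}v)\bigr)^2dt\le c_1\|u-v\|^2 .$$ Then there is $R_0>0$ such that the following holds. There exist constants $B,b>0$ such that for all $T>T_0$, all $R>R_0$ and every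 least squares estimator $\theta_T$ $$P\bigl\{\|s_T(\theta_T-\theta)\|\ge R\bigr\}\le B\exp\{-bR^2\}.\qquad(*)$$ Moreover, for every $\beta>0$ there are $B,b>0$ such that $(*)$ holds for all $T>T_0$, all $R>R_0$ and every least squares estimator $\theta_T$, and $$b\ge\frac{c_0}{16\pi f_0(1+q)}-\beta$$ (when $f_0=0$ the last inequality is read as no condition on $b$). -/

import Mathlib

open MeasureTheory

noncomputable section

/-! ### The noise -/

/-- Mean-square and almost surely continuous centred process `ε` on the whole real line. -/
structure IsContinuousCentredNoise {Ω : Type*} [MeasurableSpace Ω] (P : Measure Ω)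
    (ε : ℝ → Ω → ℝ) : Prop where
  memLp_two : ∀ t, MemLp (ε t) 2 P
  meanSquare_continuous : ∀ t,
    Filter.Tendsto (fun s => ∫ ω, (ε s ω - ε t ω) ^ 2 ∂P) (nhds t) (nhds 0)
  ae_continuous : ∀ᵐ ω ∂P, Continuous fun t => ε t ω
  centred : ∀ t, ∫ ω, ε t ω ∂P = 0

/-- A strictly sub-Gaussian random vector `ξ = (ξ₁, …, ξₙ)`:
`E exp ⟨ξ, Δ⟩ ≤ exp (⟨B Δ, Δ⟩ / 2)` for all `Δ ∈ ℝⁿ`, where `B i j = E ξ_i ξ_j`.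
Finiteness of the second moments and of the exponential moments is part of the definition. -/
structure IsStrictlySubGaussian {Ω : Type*} [MeasurableSpace Ω] (P : Measure Ω) {n : ℕ}
    (ξ : Fin n → Ω → ℝ) : Prop where
  memLp_two : ∀ i, MemLp (ξ i) 2 P
  integrable_exp : ∀ Δ : Fin n → ℝ, Integrable (fun ω => Real.exp (∑ i, ξ i ω * Δ i)) P
  exp_moment_le : ∀ Δ : Fin n → ℝ,
    ∫ ω, Real.exp (∑ i, ξ i ω * Δ i) ∂P ≤
      Real.exp (1 / 2 * ∑ i, ∑ j, (∫ ω, ξ i ω * ξ j ω ∂P) * Δ i * Δ j)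

/-- A jointly strictly sub-Gaussian process: all its finite-dimensional vectors are strictly
sub-Gaussian. -/
def IsJointlyStrictlySubGaussian {Ω : Type*} [MeasurableSpace Ω] (P : Measure Ω)
    (ε : ℝ → Ω → ℝ) : Prop :=
  ∀ n : ℕ, 1 ≤ n → ∀ t : Fin n → ℝ, IsStrictlySubGaussian P fun i => ε (t i)

/-- The (centred, square-integrable) process `ε` is wide-sense stationary with covariance function
`B(t) = E ε(0) ε(t)`, and `f` is its spectral density, `B(t) = ∫ e^{i x t} f(x) dx`; `f` is
bounded. -/
structure HasBoundedSpectralDensity {Ω : Type*} [MeasurableSpace Ω] (P : Measure Ω)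
    (ε : ℝ → Ω → ℝ) (f : ℝ → ℝ) : Prop where
  stationary : ∀ s t, ∫ ω, ε s ω * ε (s + t) ω ∂P = ∫ ω, ε 0 ω * ε t ω ∂P
  density_nonneg : ∀ x, 0 ≤ f x
  density_integrable : Integrable f
  covariance_eq : ∀ t : ℝ, ((∫ ω, ε 0 ω * ε t ω ∂P : ℝ) : ℂ) =
    ∫ x : ℝ, Complex.exp (Complex.I * (x : ℂ) * (t : ℂ)) * (f x : ℂ)
  density_bddAbove : BddAbove (Set.range f)

/-! ### The regression function and the normalization -/

/-- The regularity of the regression function: `a` is (jointly) continuous on `[0, ∞) × closure Θ`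
and `a(t, ·)` is continuously differentiable on the open set `Θ` for every `t ≥ 0`. -/
structure IsRegressionFunction {q : ℕ} (Θ : Set (EuclideanSpace ℝ (Fin q)))
    (a : ℝ → EuclideanSpace ℝ (Fin q) → ℝ) : Prop where
  continuousOn : ContinuousOn (Function.uncurry a) (Set.Ici 0 ×ˢ closure Θ)
  contDiffOn : ∀ t, 0 ≤ t → ContDiffOn ℝ 1 (a t) Θ

/-- The action of the diagonal matrix `diag (s₁, …, s_q)` on `ℝ^q`. -/
def diagAct {q : ℕ} (s : Fin q → ℝ) (x : EuclideanSpace ℝ (Fin q)) : EuclideanSpace ℝ (Fin q) :=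
  WithLp.toLp 2 fun i => s i * x i

/-- `d_{iT}(τ) = (∫₀ᵀ (∂a(t, τ)/∂τ_i)² dt)^{1/2}`. -/
def gradientNorm {q : ℕ} (a : ℝ → EuclideanSpace ℝ (Fin q) → ℝ) (T : ℝ)
    (τ : EuclideanSpace ℝ (Fin q)) (i : Fin q) : ℝ :=
  Real.sqrt (∫ t in (0 : ℝ)..T, (fderiv ℝ (a t) τ (EuclideanSpace.single i 1)) ^ 2)

/-- The diagonal normalization `s_T = diag (s_{1T}, …, s_{qT})` is comparable with
`d_T(τ) = diag (d_{1T}(τ), …, d_{qT}(τ))`, uniformly in `τ ∈ Θ` and `T > T₀`.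
(The lower bound forces `s_{iT} > 0` and the finiteness of the integral in `d_{iT}(τ)`.) -/
def IsNormalization {q : ℕ} (Θ : Set (EuclideanSpace ℝ (Fin q)))
    (a : ℝ → EuclideanSpace ℝ (Fin q) → ℝ) (s : ℝ → Fin q → ℝ) (T₀ : ℝ) : Prop :=
  ∃ cl cu : Fin q → ℝ, (∀ i, 0 < cl i ∧ cl i < cu i) ∧
    ∀ T, T₀ < T → ∀ τ ∈ Θ, ∀ i,
      cl i < (s T i)⁻¹ * gradientNorm a T τ i ∧ (s T i)⁻¹ * gradientNorm a T τ i < cu i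

/-- `Δ(t, u) = a(t, θ + s⁻¹ u) - a(t, θ)`, where `s` is a diagonal matrix. -/
def regressionIncrement {q : ℕ} (a : ℝ → EuclideanSpace ℝ (Fin q) → ℝ)
    (θ : EuclideanSpace ℝ (Fin q)) (s : Fin q → ℝ) (t : ℝ) (u : EuclideanSpace ℝ (Fin q)) : ℝ :=
  a t (θ + diagAct (fun i => (s i)⁻¹) u) - a t θ

/-- `Φ_T(u, v) = ∫₀ᵀ (Δ(t, u) - Δ(t, v))² dt`. -/
def regressionDist {q : ℕ} (a : ℝ → EuclideanSpace ℝ (Fin q) → ℝ)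
    (θ : EuclideanSpace ℝ (Fin q)) (s : Fin q → ℝ) (T : ℝ)
    (u v : EuclideanSpace ℝ (Fin q)) : ℝ :=
  ∫ t in (0 : ℝ)..T, (regressionIncrement a θ s t u - regressionIncrement a θ s t v) ^ 2

/-- `U_T(θ) = s_T (closure Θ - θ)`. -/
def normalizedParameterSet {q : ℕ} (Θ : Set (EuclideanSpace ℝ (Fin q)))
    (θ : EuclideanSpace ℝ (Fin q)) (s : Fin q → ℝ) : Set (EuclideanSpace ℝ (Fin q)) :=
  (fun τ => diagAct s (τ - θ)) '' closure Θ

/-- The two-sided condition `c₀ ‖u - v‖² ≤ Φ_T(u, v) ≤ c₁ ‖u - v‖²` on `U_T(θ)`, `T > T₀`. -/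
def IsBiLipschitzRegression {q : ℕ} (Θ : Set (EuclideanSpace ℝ (Fin q)))
    (a : ℝ → EuclideanSpace ℝ (Fin q) → ℝ) (θ : EuclideanSpace ℝ (Fin q))
    (s : ℝ → Fin q → ℝ) (T₀ c₀ c₁ : ℝ) : Prop :=
  ∀ T, T₀ < T → ∀ u ∈ normalizedParameterSet Θ θ (s T), ∀ v ∈ normalizedParameterSet Θ θ (s T),
    c₀ * ‖u - v‖ ^ 2 ≤ regressionDist a θ (s T) T u v ∧
      regressionDist a θ (s T) T u v ≤ c₁ * ‖u - v‖ ^ 2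

/-! ### The least squares estimator -/

/-- The observed process `X(t) = a(t, θ) + ε(t)`. -/
def observation {Ω : Type*} {q : ℕ} (a : ℝ → EuclideanSpace ℝ (Fin q) → ℝ)
    (θ : EuclideanSpace ℝ (Fin q)) (ε : ℝ → Ω → ℝ) (t : ℝ) (ω : Ω) : ℝ :=
  a t θ + ε t ω

/-- The least squares functional `Q_T(τ) = ∫₀ᵀ (X(t) - a(t, τ))² dt`. -/
def leastSquares {Ω : Type*} {q : ℕ} (a : ℝ → EuclideanSpace ℝ (Fin q) → ℝ)
    (X : ℝ → Ω → ℝ) (T : ℝ) (τ : EuclideanSpace ℝ (Fin q)) (ω : Ω) : ℝ :=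
  ∫ t in (0 : ℝ)..T, (X t ω - a t τ) ^ 2

/-- `θT` is a least squares estimator from the observations `X(t)`, `t ∈ [0, T]`: a random vector
with values in `closure Θ` that minimizes `Q_T` over `closure Θ`, almost surely. -/
structure IsLeastSquaresEstimator {Ω : Type*} [MeasurableSpace Ω] (P : Measure Ω) {q : ℕ}
    (Θ : Set (EuclideanSpace ℝ (Fin q))) (a : ℝ → EuclideanSpace ℝ (Fin q) → ℝ)
    (X : ℝ → Ω → ℝ) (T : ℝ) (θT : Ω → EuclideanSpace ℝ (Fin q)) : Prop where
  aemeasurable : AEMeasurable θT P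
  mem_closure : ∀ᵐ ω ∂P, θT ω ∈ closure Θ
  minimizes : ∀ᵐ ω ∂P, IsMinOn (fun τ => leastSquares a X T τ ω) (closure Θ) (θT ω)

/-- The exponential bound `P {‖s_T (θ_T - θ)‖ ≥ R} ≤ B exp (-b R²)` for all `T > T₀`, `R > R₀` and
every least squares estimator `θ_T`. -/
def LSEExponentialBound {Ω : Type*} [MeasurableSpace Ω] (P : Measure Ω) {q : ℕ}
    (Θ : Set (EuclideanSpace ℝ (Fin q))) (a : ℝ → EuclideanSpace ℝ (Fin q) → ℝ)
    (θ : EuclideanSpace ℝ (Fin q)) (ε : ℝ → Ω → ℝ) (s : ℝ → Fin q → ℝ)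
    (T₀ R₀ B b : ℝ) : Prop :=
  ∀ T, T₀ < T → ∀ R, R₀ < R → ∀ θT : Ω → EuclideanSpace ℝ (Fin q),
    IsLeastSquaresEstimator P Θ a (observation a θ ε) T θT →
      P.real {ω | R ≤ ‖diagAct (s T) (θT ω - θ)‖} ≤ B * Real.exp (-b * R ^ 2)

end

/-! Put u = s_T(θ_T - θ), V(u) = ∫₀ᵀ ε(t)Δ(t,u) dt and φ(u) = ∫₀ᵀ Δ(t,u)² dt. Expanding Q_T(θ_T) ≤
Q_T(θ) gives φ(u) ≤ 2V(u), while φ(u) ≥ c₀‖u‖². Up to a null set, the event to be bounded therefore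
forces φ(u) ≤ 2V(u) at some u ∈ U_T(θ) with ‖u‖ ≥ R.

For fixed h, the integral ∫εh is sub-Gaussian with variance proxy S∫h², where S = 2πF and F bounds
f: strict sub-Gaussianity of Riemann sums passes to the limit by Fatou, and the limiting variance ∫
f|ĥ|² is controlled by a Bessel inequality (`lintegral_exp_noise_integral_le`,
`integral_mul_fourierSq_le`). Chernoff then gives P(V(u) ≥ φ(u)/2) ≤ exp(-φ(u)/(8S)) ≤
exp(-c₀‖u‖²/(8S)).

To make this uniform in u, ℝ^q is cut into small lattice cubes. The pointwise bound is used at one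
point v of each cube, and chaining (`measure_exists_increment_gt_le`) controls the oscillation of V
inside it. Lowering the exponent from c₀/(8S) to c₀/(16S) pays for passing from v to the cube and
leaves a factor exp(-c‖v‖²), which makes the sum over cubes converge with a bound free of T
(`exists_measure_exists_le_exp`).

With F = f₀ > 0 the exponent is c₀/(32πf₀), which for q ≥ 1 is at least c₀/(16πf₀(1+q)); one b thus
serves every β. -/

/-! ### Riemann sums -/

/-- Riemann sums over the uniform partition of `[0, T]` converge to the integral. -/
theorem tendsto_riemannSum {T : ℝ} (hT : 0 < T) {g : ℝ → ℝ} (hg : ContinuousOn g (Set.Icc 0 T)) :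
    Filter.Tendsto (fun n : ℕ => ∑ i : Fin n, g ((i : ℕ) * (T / n)) * (T / n)) Filter.atTop
      (nhds (∫ t in (0 : ℝ)..T, g t)) := by
  have huc : UniformContinuousOn g (Set.Icc 0 T) :=
    isCompact_Icc.uniformContinuousOn_of_continuous hg
  rw [Metric.uniformContinuousOn_iff] at huc
  rw [Metric.tendsto_atTop]
  intro e he
  obtain ⟨d, hd, hd'⟩ := huc (e / (2 * T)) (by positivity)
  obtain ⟨N, hN⟩ := exists_nat_gt (T / d)
  refine ⟨N + 1, fun n hn => ?_⟩
  have hn0 : (0 : ℝ) < n := by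
    have : 0 < n := by omega
    exact_mod_cast this
  have hNn : (N : ℝ) ≤ n := by exact_mod_cast (by omega : N ≤ n)
  set w : ℝ := T / n with hw
  have hw0 : 0 < w := by positivity
  have hnw : n * w = T := by rw [hw]; field_simp
  have hwd : w < d := by
    rw [hw, div_lt_iff₀ hn0]
    rw [div_lt_iff₀ hd] at hN
    nlinarith
  rw [Fin.sum_univ_eq_sum_range (fun i => g ((i : ℕ) * w) * w) n]
  have hsub : ∀ k < n, Set.Icc ((k : ℝ) * w) (((k + 1 : ℕ) : ℝ) * w) ⊆ Set.Icc 0 T := by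
    intro k hk
    apply Set.Icc_subset_Icc
    · positivity
    · rw [← hnw]
      have : ((k + 1 : ℕ) : ℝ) ≤ n := by exact_mod_cast hk
      gcongr
  have hle : ∀ k : ℕ, (k : ℝ) * w ≤ ((k + 1 : ℕ) : ℝ) * w := by
    intro k; push_cast; nlinarith
  have hint : ∀ k < n, IntervalIntegrable g volume ((k : ℝ) * w) (((k + 1 : ℕ) : ℝ) * w) := by
    intro k hk
    apply ContinuousOn.intervalIntegrable
    rw [Set.uIcc_of_le (hle k)]
    exact hg.mono (hsub k hk)
  have hsum := intervalIntegral.sum_integral_adjacent_intervals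
    (a := fun k : ℕ => (k : ℝ) * w) (n := n) (f := g) (μ := volume) hint
  simp only [Nat.cast_zero, zero_mul, hnw] at hsum
  rw [← hsum, Real.dist_eq, ← Finset.sum_sub_distrib]
  have hterm : ∀ k ∈ Finset.range n,
      |g (k * w) * w - ∫ t in ((k : ℝ) * w)..(((k + 1 : ℕ) : ℝ) * w), g t| ≤ e / (2 * T) * w := by
    intro k hk
    have hk' := Finset.mem_range.1 hk
    have h1 : g (k * w) * w = ∫ _ in ((k : ℝ) * w)..(((k + 1 : ℕ) : ℝ) * w), g (k * w) := by
      rw [intervalIntegral.integral_const, smul_eq_mul]; push_cast; ring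
    rw [h1, ← intervalIntegral.integral_sub (by simp) (hint k hk')]
    have h2 := intervalIntegral.norm_integral_le_of_norm_le_const
      (f := fun t => g (k * w) - g t) (a := (k : ℝ) * w) (b := ((k + 1 : ℕ) : ℝ) * w)
      (C := e / (2 * T)) ?_
    · rw [Real.norm_eq_abs] at h2
      refine h2.trans (le_of_eq ?_)
      congr 1
      push_cast
      rw [show ((k : ℝ) + 1) * w - k * w = w by ring, abs_of_pos hw0]
    · intro t ht
      rw [Set.uIoc_of_le (hle k)] at ht
      rw [← dist_eq_norm]
      refine (hd' _ (hsub k hk' ⟨le_rfl, hle k⟩) _ (hsub k hk' ⟨ht.1.le, ht.2⟩) ?_).le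
      rw [Real.dist_eq, abs_sub_lt_iff]
      have := ht.2
      push_cast at this
      constructor <;> nlinarith [ht.1]
  calc _ ≤ ∑ k ∈ Finset.range n, e / (2 * T) * w :=
        (Finset.abs_sum_le_sum_abs _ _).trans (Finset.sum_le_sum hterm)
    _ = e / (2 * T) * (n * w) := by simp; ring
    _ = e / 2 := by rw [hnw]; field_simp
    _ < e := by linarith

/-! ### A Bessel inequality for bounded spectral densities -/

theorem integral_exp_neg_mul_sq_mul_cos {e : ℝ} (he : 0 < e) (x : ℝ) :
    ∫ y : ℝ, Real.exp (-e * y ^ 2) * Real.cos (y * x) =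
      Real.sqrt (Real.pi / e) * Real.exp (-(1 / (4 * e)) * x ^ 2) := by
  have h := fourierIntegral_gaussian (b := (e : ℂ)) (by simpa using he) (x : ℂ)
  have h2 := congrArg Complex.re h
  have hint : Integrable fun y : ℝ => Complex.exp (Complex.I * x * y) * Complex.exp (-e * y ^ 2) := by
    have := integrable_cexp_quadratic' (b := -(e : ℂ)) (by simpa using he) (Complex.I * x) 0
    refine this.congr (Filter.Eventually.of_forall fun y => ?_)
    simp only
    rw [← Complex.exp_add]; congr 1; ring
  have h3 := integral_re hint
  simp only [RCLike.re_to_complex] at h3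
  rw [← h3] at h2
  have h4 : ∀ y : ℝ, (Complex.exp (Complex.I * x * y) * Complex.exp (-e * y ^ 2)).re =
      Real.exp (-e * y ^ 2) * Real.cos (y * x) := by
    intro y
    rw [show Complex.I * x * y = ((y * x : ℝ) : ℂ) * Complex.I by push_cast; ring,
      show (-(e : ℂ) * y ^ 2) = ((-e * y ^ 2 : ℝ) : ℂ) by push_cast; ring, ← Complex.ofReal_exp,
      Complex.re_mul_ofReal, Complex.exp_ofReal_mul_I_re]
    ring
  simp only [h4] at h2
  rw [h2, show (Real.pi / (e : ℂ)) = ((Real.pi / e : ℝ) : ℂ) by push_cast; ring,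
    show -(x : ℂ) ^ 2 / (4 * e) = ((-(1 / (4 * e)) * x ^ 2 : ℝ) : ℂ) by push_cast; ring,
    ← Complex.ofReal_exp, show (1 / 2 : ℂ) = ((1 / 2 : ℝ) : ℂ) by push_cast; ring,
    ← Complex.ofReal_cpow (by positivity), ← Complex.ofReal_mul, Complex.ofReal_re,
    Real.sqrt_eq_rpow]

/-- The squared modulus of the Fourier transform of `h` at `x`, in real form. -/
noncomputable def fourierSq (h : ℝ → ℝ) (x : ℝ) : ℝ :=
  (∫ t, h t * Real.cos (x * t)) ^ 2 + (∫ t, h t * Real.sin (x * t)) ^ 2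

theorem integrable_mul_cos {h : ℝ → ℝ} (hh : Integrable h) (x : ℝ) :
    Integrable fun t => h t * Real.cos (x * t) :=
  hh.mul_bdd (c := 1) (by fun_prop) (Filter.Eventually.of_forall fun t => Real.abs_cos_le_one _)

theorem integrable_mul_sin {h : ℝ → ℝ} (hh : Integrable h) (x : ℝ) :
    Integrable fun t => h t * Real.sin (x * t) :=
  hh.mul_bdd (c := 1) (by fun_prop) (Filter.Eventually.of_forall fun t => Real.abs_sin_le_one _)

theorem fourierSq_eq_integral_prod {h : ℝ → ℝ} (hh : Integrable h) (x : ℝ) :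
    fourierSq h x = ∫ p : ℝ × ℝ, h p.1 * h p.2 * Real.cos (x * (p.1 - p.2)) := by
  have hc := integrable_mul_cos hh x
  have hs := integrable_mul_sin hh x
  rw [fourierSq, sq, sq, ← integral_prod_mul, ← integral_prod_mul,
    ← integral_add (hc.mul_prod hc) (hs.mul_prod hs)]
  refine integral_congr_ae (Filter.Eventually.of_forall fun p => ?_)
  simp only
  rw [mul_sub, Real.cos_sub]
  ring

theorem fourierSq_nonneg (h : ℝ → ℝ) (x : ℝ) : 0 ≤ fourierSq h x := by
  unfold fourierSq; positivity

theorem continuous_fourierSq {h : ℝ → ℝ} (hh : Integrable h) : Continuous (fourierSq h) := by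
  have h1 : Continuous fun x => ∫ t, h t * Real.cos (x * t) := by
    refine continuous_of_dominated (bound := fun t => |h t|)
      (fun x => (integrable_mul_cos hh x).aestronglyMeasurable) (fun x => ?_) hh.abs ?_
    · refine Filter.Eventually.of_forall fun t => ?_
      rw [norm_mul]
      exact mul_le_of_le_one_right (abs_nonneg _) (Real.abs_cos_le_one _)
    · exact Filter.Eventually.of_forall fun t => by fun_prop
  have h2 : Continuous fun x => ∫ t, h t * Real.sin (x * t) := by
    refine continuous_of_dominated (bound := fun t => |h t|)
      (fun x => (integrable_mul_sin hh x).aestronglyMeasurable) (fun x => ?_) hh.abs ?_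
    · refine Filter.Eventually.of_forall fun t => ?_
      rw [norm_mul]
      exact mul_le_of_le_one_right (abs_nonneg _) (Real.abs_sin_le_one _)
    · exact Filter.Eventually.of_forall fun t => by fun_prop
  unfold fourierSq
  fun_prop

theorem fourierSq_le {h : ℝ → ℝ} (hh : Integrable h) (x : ℝ) :
    fourierSq h x ≤ (∫ t, |h t|) ^ 2 := by
  rw [fourierSq_eq_integral_prod hh, sq, ← integral_prod_mul]
  refine (Real.le_norm_self _).trans ((norm_integral_le_integral_norm _).trans ?_)
  refine integral_mono_of_nonneg (Filter.Eventually.of_forall fun p => norm_nonneg _)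
    (hh.abs.mul_prod hh.abs) (Filter.Eventually.of_forall fun p => ?_)
  simp only [norm_mul, Real.norm_eq_abs]
  exact mul_le_of_le_one_right (by positivity) (Real.abs_cos_le_one _)

/-- Fubini turns the left side into ∬ h(s)h(t)G(s-t), where G, the transform of the Gaussian cutoff,
is positive and even with total mass 2π for every `e`. The bound h(s)h(t) ≤ (h(s)² + h(t)²)/2 then
finishes (Schur's test). -/
theorem integral_gaussian_mul_fourierSq_le {h : ℝ → ℝ} (hh : Integrable h)
    (hh2 : Integrable fun t => h t ^ 2) {e : ℝ} (he : 0 < e) :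
    ∫ x, Real.exp (-e * x ^ 2) * fourierSq h x ≤ 2 * Real.pi * ∫ t, h t ^ 2 := by
  set G : ℝ → ℝ := fun x => Real.sqrt (Real.pi / e) * Real.exp (-(1 / (4 * e)) * x ^ 2) with hG
  have hb : 0 < 1 / (4 * e) := by positivity
  have hGint : Integrable G := (integrable_exp_neg_mul_sq hb).const_mul _
  have hGval : ∫ x, G x = 2 * Real.pi := by
    rw [hG, integral_const_mul, integral_gaussian, ← Real.sqrt_mul (by positivity),
      show Real.pi / e * (Real.pi / (1 / (4 * e))) = (2 * Real.pi) ^ 2 by field_simp; ring,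
      Real.sqrt_sq (by positivity)]
  have hGeven : ∀ x y, G (x - y) = G (y - x) := by
    intro x y; simp only [hG]; rw [show (x - y) ^ 2 = (y - x) ^ 2 by ring]
  have hG0 : ∀ x, 0 ≤ G x := fun x => by simp only [hG]; positivity
  have hE : Integrable fun x : ℝ => Real.exp (-e * x ^ 2) := integrable_exp_neg_mul_sq he
  have hhh : Integrable fun p : ℝ × ℝ => h p.1 * h p.2 := hh.mul_prod hh
  have hF : Integrable (Function.uncurry fun (x : ℝ) (p : ℝ × ℝ) =>
      Real.exp (-e * x ^ 2) * (h p.1 * h p.2 * Real.cos (x * (p.1 - p.2))))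
      (volume.prod volume) := by
    have h1 := (hE.mul_prod hhh).mul_bdd (c := 1)
      (g := fun z : ℝ × (ℝ × ℝ) => Real.cos (z.1 * (z.2.1 - z.2.2))) (by fun_prop)
      (Filter.Eventually.of_forall fun t => Real.abs_cos_le_one _)
    refine h1.congr (Filter.Eventually.of_forall fun z => ?_)
    simp only [Function.uncurry]; ring
  have h1 : ∫ x, Real.exp (-e * x ^ 2) * fourierSq h x =
      ∫ p : ℝ × ℝ, h p.1 * h p.2 * G (p.1 - p.2) := by
    simp_rw [fourierSq_eq_integral_prod hh, ← integral_const_mul]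
    rw [integral_integral_swap hF]
    refine integral_congr_ae (Filter.Eventually.of_forall fun p => ?_)
    simp only [hG]
    rw [← integral_exp_neg_mul_sq_mul_cos he, ← integral_const_mul]
    refine integral_congr_ae (Filter.Eventually.of_forall fun x => ?_)
    simp only; ring
  have hI2 : Integrable (fun p : ℝ × ℝ => h p.2 ^ 2 * G (p.1 - p.2)) (volume.prod volume) :=
    hh2.convolution_integrand (ContinuousLinearMap.mul ℝ ℝ) hGint
  have hI1 : Integrable (fun p : ℝ × ℝ => h p.1 ^ 2 * G (p.1 - p.2)) (volume.prod volume) := by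
    refine hI2.swap.congr (Filter.Eventually.of_forall fun p => ?_)
    simp only [Function.comp, Prod.swap]
    rw [hGeven]
  have hv1 : ∫ p : ℝ × ℝ, h p.1 ^ 2 * G (p.1 - p.2) = 2 * Real.pi * ∫ t, h t ^ 2 := by
    rw [Measure.volume_eq_prod, integral_prod _ hI1]
    simp_rw [integral_const_mul, integral_sub_left_eq_self, hGval, integral_mul_const]
    ring
  have hv2 : ∫ p : ℝ × ℝ, h p.2 ^ 2 * G (p.1 - p.2) = 2 * Real.pi * ∫ t, h t ^ 2 := by
    rw [← hv1, Measure.volume_eq_prod, ← integral_prod_swap]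
    simp only [Prod.fst_swap, Prod.snd_swap]
    simp_rw [fun p : ℝ × ℝ => hGeven p.2 p.1]
  rw [h1]
  calc _ ≤ ∫ p : ℝ × ℝ, (1 / 2) * (h p.1 ^ 2 * G (p.1 - p.2) + h p.2 ^ 2 * G (p.1 - p.2)) := by
        refine integral_mono_ae ?_ ((hI1.add hI2).const_mul _)
          (Filter.Eventually.of_forall fun p => ?_)
        · refine hhh.mul_bdd (c := Real.sqrt (Real.pi / e))
            (g := fun p : ℝ × ℝ => G (p.1 - p.2)) ?_ (Filter.Eventually.of_forall fun p => ?_)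
          · simp only [hG]; fun_prop
          · rw [Real.norm_of_nonneg (hG0 _)]
            simp only [hG]
            refine mul_le_of_le_one_right (by positivity) ?_
            rw [Real.exp_le_one_iff]
            nlinarith [sq_nonneg (p.1 - p.2)]
        · simp only
          nlinarith [mul_nonneg (hG0 (p.1 - p.2)) (sq_nonneg (h p.1 - h p.2))]
    _ = 2 * Real.pi * ∫ t, h t ^ 2 := by
        rw [Measure.volume_eq_prod] at hv1 hv2 ⊢
        rw [integral_const_mul, integral_add hI1 hI2, hv1, hv2]
        ring

/-- A Bessel-type inequality: integrating the squared modulus of the Fourier transform against a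
density bounded by `F` gives at most `2πF ∫ h²`. -/
theorem integral_mul_fourierSq_le {h : ℝ → ℝ} (hh : Integrable h)
    (hh2 : Integrable fun t => h t ^ 2) {f : ℝ → ℝ} (hf0 : ∀ x, 0 ≤ f x) (hf : Integrable f)
    {F : ℝ} (hF : ∀ x, f x ≤ F) :
    ∫ x, f x * fourierSq h x ≤ 2 * Real.pi * F * ∫ t, h t ^ 2 := by
  set M := (∫ t, |h t|) ^ 2
  have hc := continuous_fourierSq hh
  have hexp : ∀ e : ℝ, 0 < e → ∀ x : ℝ, Real.exp (-e * x ^ 2) ≤ 1 := fun e he x => by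
    rw [Real.exp_le_one_iff]; nlinarith [sq_nonneg x]
  -- The Gaussian cutoff is removed by dominated convergence; the dominating function `f x * M` is
  -- integrable because `f` is.
  have hlim : Filter.Tendsto
      (fun e : ℝ => ∫ x, f x * (Real.exp (-e * x ^ 2) * fourierSq h x)) (nhdsWithin 0 (Set.Ioi 0))
      (nhds (∫ x, f x * fourierSq h x)) := by
    refine tendsto_integral_filter_of_dominated_convergence (fun x => f x * M) ?_ ?_
      (hf.mul_const _) ?_
    · refine Filter.Eventually.of_forall fun e => hf.aestronglyMeasurable.mul ?_
      exact Continuous.aestronglyMeasurable (by fun_prop)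
    · filter_upwards [self_mem_nhdsWithin] with e he
      refine Filter.Eventually.of_forall fun x => ?_
      rw [Real.norm_of_nonneg (mul_nonneg (hf0 x) (mul_nonneg (Real.exp_nonneg _)
        (fourierSq_nonneg h x)))]
      refine mul_le_mul_of_nonneg_left ?_ (hf0 x)
      exact (mul_le_of_le_one_left (fourierSq_nonneg h x) (hexp e he x)).trans (fourierSq_le hh x)
    · refine Filter.Eventually.of_forall fun x => ?_
      have : Continuous fun e : ℝ => f x * (Real.exp (-e * x ^ 2) * fourierSq h x) := by fun_prop
      have h0 := this.tendsto 0
      simp only [neg_zero, zero_mul, Real.exp_zero, one_mul] at h0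
      exact h0.mono_left nhdsWithin_le_nhds
  refine le_of_tendsto hlim ?_
  filter_upwards [self_mem_nhdsWithin] with e he
  have hF0 : 0 ≤ F := (hf0 0).trans (hF 0)
  calc _ ≤ ∫ x, F * (Real.exp (-e * x ^ 2) * fourierSq h x) := by
        refine integral_mono_of_nonneg (Filter.Eventually.of_forall fun x => ?_) ?_
          (Filter.Eventually.of_forall fun x => ?_)
        · exact mul_nonneg (hf0 x) (mul_nonneg (Real.exp_nonneg _) (fourierSq_nonneg h x))
        · refine Integrable.const_mul ?_ _
          refine (integrable_exp_neg_mul_sq he).mul_bdd (c := M) hc.aestronglyMeasurable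
            (Filter.Eventually.of_forall fun x => ?_)
          rw [Real.norm_of_nonneg (fourierSq_nonneg h x)]
          exact fourierSq_le hh x
        · exact mul_le_mul_of_nonneg_right (hF x)
            (mul_nonneg (Real.exp_nonneg _) (fourierSq_nonneg h x))
    _ ≤ F * (2 * Real.pi * ∫ t, h t ^ 2) := by
        rw [integral_const_mul]
        exact mul_le_mul_of_nonneg_left (integral_gaussian_mul_fourierSq_le hh hh2 he) hF0
    _ = _ := by ring

theorem integral_indicator_Ioc_mul {T : ℝ} (hT : 0 < T) (h k : ℝ → ℝ) :
    ∫ t, (Set.Ioc 0 T).indicator h t * k t = ∫ t in (0 : ℝ)..T, h t * k t := by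
  rw [intervalIntegral.integral_of_le hT.le, ← integral_indicator measurableSet_Ioc]
  refine integral_congr_ae (Filter.Eventually.of_forall fun t => ?_)
  by_cases ht : t ∈ Set.Ioc 0 T <;> simp [ht]

theorem integrable_indicator_Ioc {T : ℝ} {h : ℝ → ℝ} (hh : ContinuousOn h (Set.Icc 0 T)) :
    Integrable ((Set.Ioc 0 T).indicator h) := by
  rw [integrable_indicator_iff measurableSet_Ioc]
  exact (hh.integrableOn_compact isCompact_Icc).mono_set Set.Ioc_subset_Icc_self

/-! ### Gaussian tails of weighted integrals of the noise -/

section Noise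

variable {Ω : Type*} [MeasurableSpace Ω] {P : Measure Ω} {ε : ℝ → Ω → ℝ} {f : ℝ → ℝ}

theorem HasBoundedSpectralDensity.integrable_mul_cos (hN3 : HasBoundedSpectralDensity P ε f)
    (t : ℝ) : Integrable fun x => f x * Real.cos (x * t) :=
  hN3.density_integrable.mul_bdd (c := 1) (by fun_prop)
    (Filter.Eventually.of_forall fun x => Real.abs_cos_le_one _)

/-- The covariance is real, so taking real parts of the spectral representation suffices; evenness
of `f` is not needed. -/
theorem HasBoundedSpectralDensity.covariance_eq_integral_cos
    (hN3 : HasBoundedSpectralDensity P ε f) (s t : ℝ) :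
    ∫ ω, ε s ω * ε t ω ∂P = ∫ x, f x * Real.cos (x * (s - t)) := by
  have h1 := hN3.stationary s (t - s)
  rw [add_sub_cancel] at h1
  rw [h1]
  have h2 := congrArg Complex.re (hN3.covariance_eq (t - s))
  rw [Complex.ofReal_re] at h2
  rw [h2]
  have hint : Integrable fun x : ℝ =>
      Complex.exp (Complex.I * (x : ℂ) * ((t - s : ℝ) : ℂ)) * (f x : ℂ) := by
    refine hN3.density_integrable.ofReal.bdd_mul (c := 1) (by fun_prop)
      (Filter.Eventually.of_forall fun x => ?_)
    rw [show Complex.I * (x : ℂ) * ((t - s : ℝ) : ℂ) = ((x * (t - s) : ℝ) : ℂ) * Complex.I by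
      push_cast; ring, Complex.norm_exp_ofReal_mul_I]
  have h3 := integral_re hint
  simp only [RCLike.re_to_complex] at h3
  rw [← h3]
  refine integral_congr_ae (Filter.Eventually.of_forall fun x => ?_)
  simp only
  rw [show Complex.I * (x : ℂ) * ((t - s : ℝ) : ℂ) = ((x * (t - s) : ℝ) : ℂ) * Complex.I by
      push_cast; ring, Complex.re_mul_ofReal, Complex.exp_ofReal_mul_I_re, mul_comm, ← Real.cos_neg]
  congr 2; ring

/-- The covariance form at finitely many points, in spectral terms. -/
theorem HasBoundedSpectralDensity.sum_covariance_eq (hN3 : HasBoundedSpectralDensity P ε f)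
    {n : ℕ} (t d : Fin n → ℝ) :
    ∑ i, ∑ j, (∫ ω, ε (t i) ω * ε (t j) ω ∂P) * d i * d j =
      ∫ x, f x * ((∑ i, d i * Real.cos (x * t i)) ^ 2 + (∑ i, d i * Real.sin (x * t i)) ^ 2) := by
  simp_rw [hN3.covariance_eq_integral_cos, ← integral_mul_const]
  have hint : ∀ i j, Integrable fun x => f x * Real.cos (x * (t i - t j)) * d i * d j :=
    fun i j => ((hN3.integrable_mul_cos _).mul_const _).mul_const _
  simp_rw [fun i => (integral_finsetSum Finset.univ fun j _ => hint i j).symm]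
  rw [← integral_finsetSum Finset.univ fun i _ => integrable_finsetSum _ fun j _ => hint i j]
  refine integral_congr_ae (Filter.Eventually.of_forall fun x => ?_)
  simp only
  rw [sq, sq, Finset.sum_mul_sum, Finset.sum_mul_sum, ← Finset.sum_add_distrib, Finset.mul_sum]
  refine Finset.sum_congr rfl fun i _ => ?_
  rw [← Finset.sum_add_distrib, Finset.mul_sum]
  refine Finset.sum_congr rfl fun j _ => ?_
  rw [mul_sub, Real.cos_sub]
  ring

/-- Convergence of the covariance forms of Riemann sums. -/
theorem tendsto_integral_mul_riemannSum_sq {T : ℝ} (hT : 0 < T) {h : ℝ → ℝ}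
    (hh : ContinuousOn h (Set.Icc 0 T)) (hf : Integrable f) :
    Filter.Tendsto (fun n : ℕ => ∫ x, f x *
        ((∑ i : Fin n, h ((i : ℕ) * (T / n)) * (T / n) * Real.cos (x * ((i : ℕ) * (T / n)))) ^ 2 +
          (∑ i : Fin n, h ((i : ℕ) * (T / n)) * (T / n) * Real.sin (x * ((i : ℕ) * (T / n)))) ^ 2))
      Filter.atTop (nhds (∫ x, f x * fourierSq ((Set.Ioc 0 T).indicator h) x)) := by
  obtain ⟨M, hM⟩ := isCompact_Icc.exists_bound_of_continuousOn hh
  have hM0 : 0 ≤ M := (norm_nonneg _).trans (hM 0 ⟨le_rfl, hT.le⟩)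
  have hsum : ∀ (n : ℕ) (k : ℝ → ℝ), (∀ y, |k y| ≤ 1) →
      (∑ i : Fin n, h ((i : ℕ) * (T / n)) * (T / n) * k ((i : ℕ) * (T / n))) ^ 2 ≤ (M * T) ^ 2 := by
    intro n k hk
    rw [sq_le_sq, abs_of_nonneg (by positivity : (0 : ℝ) ≤ M * T)]
    rcases Nat.eq_zero_or_pos n with rfl | hn
    · simp; positivity
    have hn0 : (0 : ℝ) < n := by exact_mod_cast hn
    refine (Finset.abs_sum_le_sum_abs _ _).trans ?_
    calc _ ≤ ∑ i : Fin n, M * (T / n) := by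
          refine Finset.sum_le_sum fun i _ => ?_
          rw [abs_mul, abs_mul, abs_of_pos (by positivity : 0 < T / n)]
          have hi : ((i : ℕ) : ℝ) * (T / n) ∈ Set.Icc 0 T := by
            refine ⟨by positivity, ?_⟩
            have : ((i : ℕ) : ℝ) ≤ n := by exact_mod_cast i.2.le
            calc _ ≤ (n : ℝ) * (T / n) := by gcongr
              _ = T := by field_simp
          have h1 := hM _ hi
          rw [Real.norm_eq_abs] at h1
          calc _ ≤ M * (T / n) * 1 := by gcongr; exact hk _
            _ = _ := by ring
      _ = M * T := by simp; field_simp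
  refine tendsto_integral_of_dominated_convergence (fun x => |f x| * (2 * (M * T) ^ 2)) ?_
    (hf.abs.mul_const _) ?_ ?_
  · intro n
    exact hf.aestronglyMeasurable.mul (Continuous.aestronglyMeasurable (by fun_prop))
  · intro n
    refine Filter.Eventually.of_forall fun x => ?_
    rw [norm_mul, Real.norm_eq_abs, Real.norm_of_nonneg (by positivity)]
    refine mul_le_mul_of_nonneg_left ?_ (abs_nonneg _)
    have h1 := hsum n (fun y => Real.cos (x * y)) fun y => Real.abs_cos_le_one _
    have h2 := hsum n (fun y => Real.sin (x * y)) fun y => Real.abs_sin_le_one _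
    linarith
  · refine Filter.Eventually.of_forall fun x => ?_
    have h1 := tendsto_riemannSum hT (g := fun t => h t * Real.cos (x * t))
      (hh.mul (by fun_prop))
    have h2 := tendsto_riemannSum hT (g := fun t => h t * Real.sin (x * t))
      (hh.mul (by fun_prop))
    simp only [fourierSq, integral_indicator_Ioc_mul hT]
    refine Filter.Tendsto.const_mul _ (Filter.Tendsto.add (Filter.Tendsto.pow ?_ 2)
      (Filter.Tendsto.pow ?_ 2))
    · refine h1.congr fun n => Finset.sum_congr rfl fun i _ => by ring
    · refine h2.congr fun n => Finset.sum_congr rfl fun i _ => by ring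

theorem tendsto_noise_riemannSum {T : ℝ} (hT : 0 < T) (hN1 : IsContinuousCentredNoise P ε)
    {h : ℝ → ℝ} (hh : ContinuousOn h (Set.Icc 0 T)) :
    ∀ᵐ ω ∂P, Filter.Tendsto
      (fun n : ℕ => ∑ i : Fin n, ε ((i : ℕ) * (T / n)) ω * (h ((i : ℕ) * (T / n)) * (T / n)))
      Filter.atTop (nhds (∫ t in (0 : ℝ)..T, ε t ω * h t)) := by
  filter_upwards [hN1.ae_continuous] with ω hω
  refine (tendsto_riemannSum hT (g := fun t => ε t ω * h t) (hω.continuousOn.mul hh)).congr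
    fun n => Finset.sum_congr rfl fun i _ => by ring

theorem aemeasurable_noise_riemannSum (hN1 : IsContinuousCentredNoise P ε) (h : ℝ → ℝ) (T : ℝ)
    (n : ℕ) : AEMeasurable (fun ω => ∑ i : Fin n,
      ε ((i : ℕ) * (T / n)) ω * (h ((i : ℕ) * (T / n)) * (T / n))) P :=
  Finset.aemeasurable_fun_sum _ fun _ _ =>
    (hN1.memLp_two _).aestronglyMeasurable.aemeasurable.mul_const _

theorem aemeasurable_noise_integral {T : ℝ} (hT : 0 < T) (hN1 : IsContinuousCentredNoise P ε)
    {h : ℝ → ℝ} (hh : ContinuousOn h (Set.Icc 0 T)) :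
    AEMeasurable (fun ω => ∫ t in (0 : ℝ)..T, ε t ω * h t) P :=
  aemeasurable_of_tendsto_metrizable_ae Filter.atTop (aemeasurable_noise_riemannSum hN1 h T)
    (tendsto_noise_riemannSum hT hN1 hh)

/-- The weighted integral of a jointly strictly sub-Gaussian stationary process is sub-Gaussian,
with variance proxy `2πF ∫ h²`. -/
theorem lintegral_exp_noise_integral_le {T : ℝ} (hT : 0 < T) (hN1 : IsContinuousCentredNoise P ε)
    (hN2 : IsJointlyStrictlySubGaussian P ε) (hN3 : HasBoundedSpectralDensity P ε f)
    {F : ℝ} (hF : ∀ x, f x ≤ F) {h : ℝ → ℝ} (hh : ContinuousOn h (Set.Icc 0 T)) :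
    ∫⁻ ω, ENNReal.ofReal (Real.exp (∫ t in (0 : ℝ)..T, ε t ω * h t)) ∂P ≤
      ENNReal.ofReal (Real.exp (Real.pi * F * ∫ t in (0 : ℝ)..T, h t ^ 2)) := by
  set S : ℕ → Ω → ℝ := fun n ω => ∑ i : Fin n,
    ε ((i : ℕ) * (T / n)) ω * (h ((i : ℕ) * (T / n)) * (T / n)) with hS
  set v : ℕ → ℝ := fun n => ∫ x, f x *
        ((∑ i : Fin n, h ((i : ℕ) * (T / n)) * (T / n) * Real.cos (x * ((i : ℕ) * (T / n)))) ^ 2 +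
          (∑ i : Fin n, h ((i : ℕ) * (T / n)) * (T / n) * Real.sin (x * ((i : ℕ) * (T / n)))) ^ 2)
    with hv
  have hvlim := tendsto_integral_mul_riemannSum_sq hT hh hN3.density_integrable
  have hbound : ∀ n : ℕ, 1 ≤ n → ∫⁻ ω, ENNReal.ofReal (Real.exp (S n ω)) ∂P ≤
      ENNReal.ofReal (Real.exp (1 / 2 * v n)) := by
    intro n hn
    have hG := hN2 n hn fun i => (i : ℕ) * (T / n)
    rw [← ofReal_integral_eq_lintegral_ofReal
      (hG.integrable_exp fun i => h ((i : ℕ) * (T / n)) * (T / n))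
      (Filter.Eventually.of_forall fun ω => Real.exp_nonneg _)]
    refine ENNReal.ofReal_le_ofReal ((hG.exp_moment_le _).trans_eq ?_)
    rw [hN3.sum_covariance_eq]
  -- Fatou's lemma: only finite-dimensional exponential moments are given, and the integral is
  -- almost surely the limit of the Riemann sums.
  calc _ = ∫⁻ ω, Filter.liminf (fun n => ENNReal.ofReal (Real.exp (S n ω))) Filter.atTop ∂P := by
        refine lintegral_congr_ae ?_
        filter_upwards [tendsto_noise_riemannSum hT hN1 hh] with ω hω
        refine (Filter.Tendsto.liminf_eq ?_).symm
        exact ENNReal.tendsto_ofReal ((Real.continuous_exp.tendsto _).comp hω)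
    _ ≤ Filter.liminf (fun n => ∫⁻ ω, ENNReal.ofReal (Real.exp (S n ω)) ∂P) Filter.atTop :=
        lintegral_liminf_le' fun n => (Real.measurable_exp.comp_aemeasurable
          (aemeasurable_noise_riemannSum hN1 h T n)).ennreal_ofReal
    _ ≤ Filter.liminf (fun n => ENNReal.ofReal (Real.exp (1 / 2 * v n))) Filter.atTop :=
        Filter.liminf_le_liminf (Filter.eventually_atTop.2 ⟨1, hbound⟩)
    _ = ENNReal.ofReal (Real.exp (1 / 2 * ∫ x, f x * fourierSq ((Set.Ioc 0 T).indicator h) x)) :=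
        Filter.Tendsto.liminf_eq (ENNReal.tendsto_ofReal ((Real.continuous_exp.tendsto _).comp
          (hvlim.const_mul _)))
    _ ≤ _ := by
        have hsq : (fun t => (Set.Ioc 0 T).indicator h t ^ 2) =
            (Set.Ioc 0 T).indicator fun t => h t ^ 2 := by
          funext t
          by_cases ht : t ∈ Set.Ioc 0 T <;> simp [ht]
        have h1 := integral_mul_fourierSq_le (integrable_indicator_Ioc hh)
          (by rw [hsq]; exact integrable_indicator_Ioc (hh.pow 2)) hN3.density_nonneg
          hN3.density_integrable hF
        rw [hsq, integral_indicator measurableSet_Ioc,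
          ← intervalIntegral.integral_of_le hT.le] at h1
        refine ENNReal.ofReal_le_ofReal (Real.exp_le_exp.2 ?_)
        linarith

/-- The Gaussian tail of the weighted integrals of the noise. -/
theorem measure_noise_integral_ge_le {T : ℝ} (hT : 0 < T) (hN1 : IsContinuousCentredNoise P ε)
    (hN2 : IsJointlyStrictlySubGaussian P ε) (hN3 : HasBoundedSpectralDensity P ε f)
    {F : ℝ} (hF0 : 0 < F) (hF : ∀ x, f x ≤ F) {h : ℝ → ℝ} (hh : ContinuousOn h (Set.Icc 0 T))
    {M : ℝ} (hM0 : 0 < M) (hM : ∫ t in (0 : ℝ)..T, h t ^ 2 ≤ M) {x : ℝ} (hx : 0 ≤ x) :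
    P {ω | x ≤ ∫ t in (0 : ℝ)..T, ε t ω * h t} ≤
      ENNReal.ofReal (Real.exp (-(x ^ 2 / (2 * (2 * Real.pi * F) * M)))) := by
  have hpi := Real.pi_pos
  -- Chernoff parameter: the minimizer of πFMl² - lx.
  set l : ℝ := x / (2 * Real.pi * F * M) with hl
  have hl0 : 0 ≤ l := by positivity
  have h1 := lintegral_exp_noise_integral_le hT hN1 hN2 hN3 hF (h := fun t => l * h t)
    (continuousOn_const.mul hh)
  have h2 : ∀ ω, ∫ t in (0 : ℝ)..T, ε t ω * (l * h t) = l * ∫ t in (0 : ℝ)..T, ε t ω * h t := by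
    intro ω
    rw [← intervalIntegral.integral_const_mul]
    refine intervalIntegral.integral_congr fun t _ => ?_
    ring
  have h3 : ∫ t in (0 : ℝ)..T, (l * h t) ^ 2 = l ^ 2 * ∫ t in (0 : ℝ)..T, h t ^ 2 := by
    rw [← intervalIntegral.integral_const_mul]
    refine intervalIntegral.integral_congr fun t _ => ?_
    ring
  simp only [h2, h3] at h1
  have hmeas : AEMeasurable (fun ω => ENNReal.ofReal
      (Real.exp (l * ∫ t in (0 : ℝ)..T, ε t ω * h t))) P :=
    (Real.measurable_exp.comp_aemeasurable
      ((aemeasurable_noise_integral hT hN1 hh).const_mul l)).ennreal_ofReal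
  have h4 := mul_meas_ge_le_lintegral₀ hmeas (ENNReal.ofReal (Real.exp (l * x)))
  have hsub : {ω | x ≤ ∫ t in (0 : ℝ)..T, ε t ω * h t} ⊆
      {ω | ENNReal.ofReal (Real.exp (l * x)) ≤
        ENNReal.ofReal (Real.exp (l * ∫ t in (0 : ℝ)..T, ε t ω * h t))} := by
    intro ω hω
    refine ENNReal.ofReal_le_ofReal (Real.exp_le_exp.2 ?_)
    exact mul_le_mul_of_nonneg_left hω hl0
  have h5 : ENNReal.ofReal (Real.exp (l * x)) * P {ω | x ≤ ∫ t in (0 : ℝ)..T, ε t ω * h t} ≤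
      ENNReal.ofReal (Real.exp (Real.pi * F * (l ^ 2 * M))) := by
    refine (mul_le_mul_right (measure_mono hsub) _).trans (h4.trans (h1.trans ?_))
    gcongr
  have h6 : ENNReal.ofReal (Real.exp (-(l * x))) * ENNReal.ofReal (Real.exp (l * x)) = 1 := by
    rw [← ENNReal.ofReal_mul (Real.exp_nonneg _), ← Real.exp_add]
    simp
  calc _ = ENNReal.ofReal (Real.exp (-(l * x))) * (ENNReal.ofReal (Real.exp (l * x)) *
        P {ω | x ≤ ∫ t in (0 : ℝ)..T, ε t ω * h t}) := by rw [← mul_assoc, h6, one_mul]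
    _ ≤ ENNReal.ofReal (Real.exp (-(l * x))) *
        ENNReal.ofReal (Real.exp (Real.pi * F * (l ^ 2 * M))) := by gcongr
    _ = _ := by
        rw [← ENNReal.ofReal_mul (Real.exp_nonneg _), ← Real.exp_add]
        congr 2
        rw [hl]; field_simp; ring

end Noise

/-! ### Nets and chaining in a cube -/

/-- A small `η` keeps the factor of the main term `x` near 1, at the price of a large factor on the
small term `y`. -/
theorem norm_add_sq_le_weighted {E : Type*} [SeminormedAddCommGroup E] {η : ℝ} (hη : 0 < η)
    (x y : E) : ‖x + y‖ ^ 2 ≤ (1 + η) * ‖x‖ ^ 2 + (1 + 1 / η) * ‖y‖ ^ 2 := by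
  have h1 : ‖x + y‖ ^ 2 ≤ (‖x‖ + ‖y‖) ^ 2 := by gcongr; exact norm_add_le x y
  have h2 : (1 + η) * ‖x‖ ^ 2 + (1 + 1 / η) * ‖y‖ ^ 2 - (‖x‖ + ‖y‖) ^ 2 =
      (η * ‖x‖ - ‖y‖) ^ 2 / η := by field_simp; ring
  have h3 : 0 ≤ (η * ‖x‖ - ‖y‖) ^ 2 / η := by positivity
  linarith

section Nets

variable {q : ℕ} {K : Set (EuclideanSpace ℝ (Fin q))} {z : Fin q → ℝ} {δ : ℝ}

theorem norm_sub_sq_le_of_forall_abs_le {u v : EuclideanSpace ℝ (Fin q)} {r : ℝ}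
    (h : ∀ i, |u i - v i| ≤ r) : ‖u - v‖ ^ 2 ≤ q * r ^ 2 := by
  rw [EuclideanSpace.norm_sq_eq]
  calc _ ≤ ∑ _i : Fin q, r ^ 2 := by
        refine Finset.sum_le_sum fun i _ => ?_
        rw [Real.norm_eq_abs, PiLp.sub_apply]
        gcongr
        exact h i
    _ = _ := by simp

/-- A subset of a half-open cube of side `δ` has a net of at most `M ^ q` of its points, with mesh
`√q δ / M`. -/
theorem exists_net_of_subset_cube (hδ : 0 < δ) (hK : ∀ u ∈ K, ∀ i, z i ≤ u i ∧ u i < z i + δ)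
    {M : ℕ} (hM : 0 < M) :
    ∃ N : Finset (EuclideanSpace ℝ (Fin q)), (∀ w ∈ N, w ∈ K) ∧ N.card ≤ M ^ q ∧
      ∀ u ∈ K, ∃ w ∈ N, ‖u - w‖ ^ 2 ≤ q * (δ / M) ^ 2 := by
  classical
  have hM0 : (0 : ℝ) < M := by exact_mod_cast hM
  -- Index of the subcube of side δ/M containing `u`; half-openness of the cube keeps it below `M`.
  -- One point of `K` is then chosen in each subcube that meets `K`, since the tail bounds are
  -- available on `K` only.
  set c : EuclideanSpace ℝ (Fin q) → Fin q → ℕ := fun u i => ⌊(u i - z i) / δ * M⌋₊ with hc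
  have hcell : ∀ u ∈ K, c u ∈ Fintype.piFinset fun _ : Fin q => Finset.range M := by
    intro u hu
    rw [Fintype.mem_piFinset]
    intro i
    obtain ⟨h1, h2⟩ := hK u hu i
    rw [Finset.mem_range, hc, Nat.floor_lt (by have := sub_nonneg.2 h1; positivity)]
    have : (u i - z i) / δ < 1 := by rw [div_lt_one hδ]; linarith
    nlinarith
  have hdist : ∀ u ∈ K, ∀ w ∈ K, c u = c w → ‖u - w‖ ^ 2 ≤ q * (δ / M) ^ 2 := by
    intro u hu w hw h
    refine norm_sub_sq_le_of_forall_abs_le fun i => ?_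
    have h1 := sub_nonneg.2 (hK u hu i).1
    have h2 := sub_nonneg.2 (hK w hw i).1
    have hi : ⌊(u i - z i) / δ * M⌋₊ = ⌊(w i - z i) / δ * M⌋₊ := congrFun h i
    have a1 := Nat.floor_le (by positivity : 0 ≤ (u i - z i) / δ * M)
    have a2 := Nat.lt_floor_add_one ((u i - z i) / δ * M)
    have b1 := Nat.floor_le (by positivity : 0 ≤ (w i - z i) / δ * M)
    have b2 := Nat.lt_floor_add_one ((w i - z i) / δ * M)
    rw [hi] at a1 a2
    have h3 : u i - w i = ((u i - z i) / δ * M - (w i - z i) / δ * M) * (δ / M) := by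
      field_simp; ring
    rw [h3, abs_mul, abs_of_pos (by positivity : 0 < δ / M)]
    refine mul_le_of_le_one_left (by positivity) ?_
    rw [abs_le]
    constructor <;> linarith
  set g : (Fin q → ℕ) → EuclideanSpace ℝ (Fin q) :=
    fun k => if h : ∃ u ∈ K, c u = k then h.choose else 0 with hg
  have hgs : ∀ k, (∃ u ∈ K, c u = k) → g k ∈ K ∧ c (g k) = k := by
    intro k h
    simp only [hg, dif_pos h]
    exact h.choose_spec
  refine ⟨((Fintype.piFinset fun _ : Fin q => Finset.range M).filter
    fun k => ∃ u ∈ K, c u = k).image g, ?_, ?_, ?_⟩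
  · intro w hw
    obtain ⟨k, hk, rfl⟩ := Finset.mem_image.1 hw
    exact (hgs k (Finset.mem_filter.1 hk).2).1
  · refine Finset.card_image_le.trans ((Finset.card_filter_le _ _).trans ?_)
    simp
  · intro u hu
    have hk := hgs (c u) ⟨u, hu, rfl⟩
    exact ⟨g (c u), Finset.mem_image_of_mem _ (Finset.mem_filter.2 ⟨hcell u hu, u, hu, rfl⟩),
      hdist u hu _ hk.1 hk.2.symm⟩

end Nets

/-- The left side is the number of links at level `i` times the tail of one link. Bernoulli gives
(9/4)^i ≥ 1 + i, and exp(-A) ≤ 2^(-(2q+1)) absorbs the growth 2^(2qi), leaving 2^(-i). -/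
theorem chaining_level_bound {q : ℕ} {A : ℝ} (hA : 2 * (q : ℝ) + 1 ≤ A) (i : ℕ) :
    ((2 : ℝ) ^ i) ^ q * ((2 : ℝ) ^ (i + 1)) ^ q * Real.exp (-(A * (9 / 4) ^ i)) ≤
      2 ^ q * Real.exp (-A) * (1 / 2) ^ i := by
  have h1 : 1 + (i : ℝ) ≤ (9 / 4 : ℝ) ^ i := by
    have := one_add_mul_le_pow (by norm_num : (-2 : ℝ) ≤ 5 / 4) i
    norm_num at this
    have hi : (0 : ℝ) ≤ i := Nat.cast_nonneg i
    linarith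
  have hA0 : 0 < A := by have : (0 : ℝ) ≤ q := Nat.cast_nonneg q
                         linarith
  have h2 : Real.exp (-(A * (9 / 4) ^ i)) ≤ Real.exp (-A) * Real.exp (-A) ^ i := by
    rw [← Real.exp_nat_mul, ← Real.exp_add]
    refine Real.exp_le_exp.2 ?_
    nlinarith
  have h3 : Real.exp (-A) ≤ (1 / 2) ^ (2 * q + 1) := by
    have h4 : Real.exp (-1) ≤ 1 / 2 := by
      rw [Real.exp_neg, one_div]
      refine inv_anti₀ (by norm_num) ?_
      have := Real.add_one_le_exp (1 : ℝ)
      linarith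
    calc Real.exp (-A) ≤ Real.exp (((2 * q + 1 : ℕ) : ℝ) * (-1)) := by
          refine Real.exp_le_exp.2 ?_
          push_cast; linarith
      _ = Real.exp (-1) ^ (2 * q + 1) := Real.exp_nat_mul _ _
      _ ≤ _ := by gcongr
  calc _ ≤ ((2 : ℝ) ^ i) ^ q * ((2 : ℝ) ^ (i + 1)) ^ q *
        (Real.exp (-A) * ((1 / 2) ^ (2 * q + 1)) ^ i) := by
        gcongr
        exact h2.trans (by gcongr)
    _ = 2 ^ q * Real.exp (-A) * (1 / 2) ^ i := by
        have : ((2 : ℝ) ^ i) ^ q * ((2 : ℝ) ^ (i + 1)) ^ q * ((1 / 2) ^ (2 * q + 1)) ^ i =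
            2 ^ q * (1 / 2) ^ i := by
          simp only [← pow_mul, one_div, inv_pow]
          rw [← pow_add]
          field_simp
          simp only [← pow_add]
          congr 1
          ring
        linear_combination Real.exp (-A) * this

/-- Chaining in a cube: the supremum over a subset of a cube of a process with sub-Gaussian
increments has a sub-Gaussian tail at the scale of the cube. -/
theorem measure_exists_increment_gt_le {Ω : Type*} [MeasurableSpace Ω] {P : Measure Ω} {q : ℕ}
    {K : Set (EuclideanSpace ℝ (Fin q))} {z : Fin q → ℝ} {δ : ℝ} (hδ : 0 < δ) (hq : 0 < q)
    (hK : ∀ u ∈ K, ∀ i, z i ≤ u i ∧ u i < z i + δ) {v : EuclideanSpace ℝ (Fin q)} (hv : v ∈ K)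
    {V : EuclideanSpace ℝ (Fin q) → Ω → ℝ} (hcont : ∀ᵐ ω ∂P, ContinuousOn (fun u => V u ω) K)
    {L : ℝ} (hL : 0 < L)
    (htail : ∀ u ∈ K, ∀ w ∈ K, ∀ r, 0 < r → ‖u - w‖ ^ 2 ≤ r → ∀ x, 0 ≤ x →
      P {ω | x ≤ V u ω - V w ω} ≤ ENNReal.ofReal (Real.exp (-(x ^ 2 / (L * r)))))
    {x : ℝ} (hx : 0 ≤ x) {A : ℝ} (hA : A = x ^ 2 / (36 * L * (q * δ ^ 2)))
    (hAq : 2 * (q : ℝ) + 1 ≤ A) :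
    P {ω | ∃ u ∈ K, x < V u ω - V v ω} ≤ ENNReal.ofReal (2 ^ (q + 1) * Real.exp (-A)) := by
  have hq0 : (0 : ℝ) < q := by exact_mod_cast hq
  set d : ℝ := q * δ ^ 2 with hd
  have hd0 : 0 < d := by positivity
  -- Level 0 is forced to be `{v}`, so that every chain starts at `v`.
  have hnet : ∀ i : ℕ, ∃ N : Finset (EuclideanSpace ℝ (Fin q)), (i = 0 → N = {v}) ∧
      (∀ w ∈ N, w ∈ K) ∧ N.card ≤ (2 ^ i) ^ q ∧
      ∀ u ∈ K, ∃ w ∈ N, ‖u - w‖ ^ 2 ≤ d * (1 / 4) ^ i := by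
    intro i
    rcases Nat.eq_zero_or_pos i with rfl | hi
    · refine ⟨{v}, fun _ => rfl, by simpa using hv, by simp, fun u hu => ⟨v, by simp, ?_⟩⟩
      rw [pow_zero, mul_one]
      refine norm_sub_sq_le_of_forall_abs_le fun i => ?_
      have h1 := hK u hu i
      have h2 := hK v hv i
      rw [abs_le]; constructor <;> linarith
    · obtain ⟨N, h1, h2, h3⟩ := exists_net_of_subset_cube hδ hK (M := 2 ^ i) (by positivity)
      refine ⟨N, fun h => absurd h hi.ne', h1, h2, fun u hu => ?_⟩
      obtain ⟨w, hw, hw'⟩ := h3 u hu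
      refine ⟨w, hw, hw'.trans_eq ?_⟩
      rw [hd, div_pow, Nat.cast_pow, Nat.cast_ofNat, ← pow_mul, mul_comm i 2, pow_mul]
      rw [one_div, inv_pow]
      norm_num
      field_simp
  choose N hN0 hNK hNcard hNnear using hnet
  -- Consecutive net points satisfy ‖w_{i+1} - w_i‖² ≤ (3/2)d4^(-i) + 3d4^(-i-1) = r_i. The
  -- thresholds y_i sum to x, and y_i decays more slowly than √r_i, so the exponent grows like
  -- (9/4)^i.
  set r : ℕ → ℝ := fun i => 9 / 4 * d * (1 / 4) ^ i with hr
  set y : ℕ → ℝ := fun i => x * ((3 / 4) ^ i / 4) with hy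
  set Bad : ℕ → Set Ω := fun i => ⋃ p ∈ (N i ×ˢ N (i + 1)).filter
    (fun p => ‖p.2 - p.1‖ ^ 2 ≤ r i), {ω | y i ≤ V p.2 ω - V p.1 ω} with hBad
  have hexp : ∀ i, y i ^ 2 / (L * r i) = A * (9 / 4) ^ i := by
    intro i
    rw [hA]
    simp only [hy, hr]
    have h1 : ((3 / 4 : ℝ) ^ i) ^ 2 = (9 / 4) ^ i * (1 / 4) ^ i := by
      rw [← pow_mul, mul_comm i 2, pow_mul, ← mul_pow]; norm_num
    rw [mul_pow, div_pow, h1]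
    field_simp
    ring
  have hPBad : ∀ i, P (Bad i) ≤ ENNReal.ofReal (2 ^ q * Real.exp (-A) * (1 / 2) ^ i) := by
    intro i
    refine (measure_biUnion_finset_le _ _).trans ?_
    calc _ ≤ ∑ p ∈ (N i ×ˢ N (i + 1)).filter (fun p => ‖p.2 - p.1‖ ^ 2 ≤ r i),
          ENNReal.ofReal (Real.exp (-(A * (9 / 4) ^ i))) := by
          refine Finset.sum_le_sum fun p hp => ?_
          obtain ⟨hp1, hp2⟩ := Finset.mem_filter.1 hp
          obtain ⟨hp3, hp4⟩ := Finset.mem_product.1 hp1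
          rw [← hexp]
          exact htail _ (hNK _ _ hp4) _ (hNK _ _ hp3) _ (by simp only [hr]; positivity) hp2 _
            (by simp only [hy]; positivity)
      _ ≤ ENNReal.ofReal (((2 : ℝ) ^ i) ^ q * ((2 : ℝ) ^ (i + 1)) ^ q *
          Real.exp (-(A * (9 / 4) ^ i))) := by
          rw [Finset.sum_const, nsmul_eq_mul, ENNReal.ofReal_mul (by positivity)]
          gcongr
          rw [← ENNReal.ofReal_natCast]
          refine ENNReal.ofReal_le_ofReal ?_
          calc _ ≤ (((N i ×ˢ N (i + 1)).card : ℕ) : ℝ) := by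
                exact_mod_cast Finset.card_filter_le _ _
            _ ≤ _ := by
                rw [Finset.card_product]
                exact_mod_cast Nat.mul_le_mul (hNcard i) (hNcard (i + 1))
      _ ≤ _ := ENNReal.ofReal_le_ofReal (chaining_level_bound hAq i)
  -- If no link is bad, telescoping bounds V by x + V(v) along the chain, and continuity on `K`
  -- carries the bound to `u`.
  have hsub : {ω | ∃ u ∈ K, x < V u ω - V v ω} ⊆
      {ω | ¬ ContinuousOn (fun u => V u ω) K} ∪ ⋃ i, Bad i := by
    rintro ω ⟨u, hu, hxu⟩
    by_contra hω
    simp only [Set.mem_union, Set.mem_iUnion, not_or, not_exists, Set.mem_ofPred_eq, not_not] at hω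
    obtain ⟨hc, hB⟩ := hω
    choose w hwN hwd using fun i => hNnear i u hu
    have hw0 : w 0 = v := by
      have := hwN 0
      rw [hN0 0 rfl] at this
      simpa using this
    have hstep : ∀ i, V (w (i + 1)) ω - V (w i) ω < y i := by
      intro i
      by_contra hlt
      refine hB i ?_
      simp only [hBad, Set.mem_iUnion]
      refine ⟨(w i, w (i + 1)), Finset.mem_filter.2
        ⟨Finset.mem_product.2 ⟨hwN i, hwN (i + 1)⟩, ?_⟩, not_lt.1 hlt⟩
      have h1 := norm_add_sq_le_weighted (by norm_num : (0 : ℝ) < 1 / 2) (u - w i)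
        (w (i + 1) - u)
      rw [show u - w i + (w (i + 1) - u) = w (i + 1) - w i by abel,
        norm_sub_rev (w (i + 1)) u] at h1
      have h2 := hwd i
      have h3 := hwd (i + 1)
      rw [pow_succ (1 / 4 : ℝ)] at h3
      simp only [hr]
      norm_num at h1 h2 h3 ⊢
      linarith
    have hsum : ∀ n, V (w n) ω - V v ω ≤ x * (1 - (3 / 4) ^ n) := by
      intro n
      induction n with
      | zero => rw [hw0]; simp
      | succ n ih =>
        have := hstep n
        simp only [hy] at this
        rw [pow_succ]
        linarith
    have hwlim : Filter.Tendsto w Filter.atTop (nhds u) := by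
      rw [tendsto_iff_norm_sub_tendsto_zero]
      have h1 : Filter.Tendsto (fun n : ℕ => Real.sqrt (d * (1 / 4) ^ n)) Filter.atTop
          (nhds 0) := by
        have h2 := (tendsto_pow_atTop_nhds_zero_of_lt_one (by norm_num : (0 : ℝ) ≤ 1 / 4)
          (by norm_num)).const_mul d
        rw [mul_zero] at h2
        have h3 := (Real.continuous_sqrt.tendsto 0).comp h2
        rwa [Real.sqrt_zero] at h3
      refine squeeze_zero (fun n => norm_nonneg _) (fun n => ?_) h1
      refine Real.le_sqrt_of_sq_le ?_
      rw [norm_sub_rev]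
      exact hwd n
    have hVlim : Filter.Tendsto (fun n => V (w n) ω - V v ω) Filter.atTop
        (nhds (V u ω - V v ω)) := by
      refine Filter.Tendsto.sub_const ?_ _
      exact (hc u hu).tendsto.comp (tendsto_nhdsWithin_iff.2
        ⟨hwlim, Filter.Eventually.of_forall fun n => hNK _ _ (hwN n)⟩)
    have hle : V u ω - V v ω ≤ x := by
      refine le_of_tendsto' hVlim fun n => (hsum n).trans ?_
      refine mul_le_of_le_one_right hx ?_
      have : (0 : ℝ) ≤ (3 / 4) ^ n := by positivity
      linarith
    linarith
  calc _ ≤ P {ω | ¬ ContinuousOn (fun u => V u ω) K} + P (⋃ i, Bad i) :=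
        (measure_mono hsub).trans (measure_union_le _ _)
    _ = P (⋃ i, Bad i) := by rw [ae_iff.1 hcont, zero_add]
    _ ≤ ∑' i, P (Bad i) := measure_iUnion_le _
    _ ≤ ∑' i : ℕ, ENNReal.ofReal (2 ^ q * Real.exp (-A) * (1 / 2) ^ i) :=
        ENNReal.tsum_le_tsum hPBad
    _ = ENNReal.ofReal (∑' i : ℕ, 2 ^ q * Real.exp (-A) * (1 / 2) ^ i) :=
        (ENNReal.ofReal_tsum_of_nonneg (fun i => by positivity)
          (summable_geometric_two.mul_left _)).symm
    _ = _ := by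
        rw [tsum_mul_left, tsum_geometric_two]
        congr 1; ring

/-! ### Large deviations by a lattice covering -/

theorem ENNReal.tsum_pi_prod (g : ℤ → ENNReal) (q : ℕ) :
    ∑' j : Fin q → ℤ, ∏ i, g (j i) = (∑' k, g k) ^ q := by
  induction q with
  | zero => simp
  | succ n ih =>
    rw [← (Fin.consEquiv fun _ : Fin (n + 1) => ℤ).tsum_eq, ENNReal.tsum_prod', pow_succ', ← ih,
      ← ENNReal.tsum_mul_right]
    refine tsum_congr fun k => ?_
    rw [← ENNReal.tsum_mul_left]
    refine tsum_congr fun j => ?_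
    rw [Fin.prod_univ_succ]
    rfl

theorem summable_int_exp_neg_mul_sq {c : ℝ} (hc : 0 < c) :
    Summable fun k : ℤ => Real.exp (-c * (k : ℝ) ^ 2) := by
  have h : Summable fun k : ℕ => Real.exp (-c * (k : ℝ) ^ 2) := by
    refine Summable.of_nonneg_of_le (fun k => Real.exp_nonneg _) (fun k => ?_)
      (summable_geometric_of_lt_one (Real.exp_nonneg (-c)) (by rw [Real.exp_lt_one_iff]; linarith))
    rw [← Real.exp_nat_mul]
    refine Real.exp_le_exp.2 ?_
    have : (k : ℝ) ≤ (k : ℝ) ^ 2 := by exact_mod_cast Nat.le_self_pow two_ne_zero k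
    nlinarith
  refine Summable.of_nat_of_neg (by simpa using h) (by simpa using h)

/-- Gaussian sums over points chosen in the cells of a cubic lattice are uniformly bounded. -/
theorem exists_tsum_cells_exp_le (q : ℕ) {c δ : ℝ} (hc : 0 < c) (hδ : 0 < δ) :
    ∃ G : ℝ, 0 ≤ G ∧ ∀ v : (Fin q → ℤ) → EuclideanSpace ℝ (Fin q),
      (∀ j i, δ * j i ≤ v j i ∧ v j i ≤ δ * j i + δ) →
        ∑' j, ENNReal.ofReal (Real.exp (-c * ‖v j‖ ^ 2)) ≤ ENNReal.ofReal G := by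
  set g : ℤ → ENNReal := fun k =>
    ENNReal.ofReal (Real.exp (c * δ ^ 2) * Real.exp (-(c * δ ^ 2 / 2) * (k : ℝ) ^ 2)) with hg
  have hgs : ∑' k, g k ≠ ⊤ :=
    ((summable_int_exp_neg_mul_sq (by positivity : 0 < c * δ ^ 2 / 2)).mul_left
      _).tsum_ofReal_ne_top
  refine ⟨((∑' k, g k) ^ q).toReal, ENNReal.toReal_nonneg, fun v hv => ?_⟩
  rw [ENNReal.ofReal_toReal (ENNReal.pow_ne_top hgs), ← ENNReal.tsum_pi_prod]
  refine ENNReal.tsum_le_tsum fun j => ?_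
  rw [hg, ← ENNReal.ofReal_prod_of_nonneg fun i _ => by positivity]
  refine ENNReal.ofReal_le_ofReal ?_
  rw [EuclideanSpace.norm_sq_eq, Finset.mul_sum, Real.exp_sum]
  refine Finset.prod_le_prod (fun i _ => Real.exp_nonneg _) fun i _ => ?_
  rw [← Real.exp_add, Real.norm_eq_abs, sq_abs]
  refine Real.exp_le_exp.2 ?_
  obtain ⟨h1, h2⟩ := hv j i
  have h3 : (v j i - δ * j i) ^ 2 ≤ δ ^ 2 := by
    apply sq_le_sq'
    · linarith
    · linarith
  -- From v² + (v - δj)² - (δj)²/2 = (2v - δj)²/2 ≥ 0. This gives a coordinatewise bound independent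
  -- of the chosen points, so the lattice sum becomes a q-th power.
  have h4 : δ ^ 2 * (j i : ℝ) ^ 2 / 2 - δ ^ 2 ≤ v j i ^ 2 := by
    nlinarith [sq_nonneg (2 * v j i - δ * j i)]
  nlinarith

section LargeDeviation

variable {q : ℕ} {S c₀ c₁ : ℝ}

/-- The squared diameter of the cells in the covering argument. -/
noncomputable def cellDiamSq (q : ℕ) (S c₀ c₁ : ℝ) : ℝ :=
  c₀ ^ 2 / (180000 * S * c₁ * (c₀ / (8 * S) + 4 * (2 * q + 1)))

theorem cellDiamSq_pos (hS : 0 < S) (hc₀ : 0 < c₀) (hc₁ : c₀ < c₁) : 0 < cellDiamSq q S c₀ c₁ := by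
  have : 0 < c₁ := hc₀.trans hc₁
  unfold cellDiamSq; positivity

/-- 420 = 20 · 21: the error 21c₁d in comparing φ at two points of a cell is at most c₀/20. -/
theorem cellDiamSq_mul_le (hS : 0 < S) (hc₀ : 0 < c₀) (hc₁ : c₀ < c₁) :
    420 * (c₁ * cellDiamSq q S c₀ c₁) ≤ c₀ := by
  have h1 : 0 < c₁ := hc₀.trans hc₁
  unfold cellDiamSq
  rw [← mul_div_assoc, ← mul_div_assoc, div_le_iff₀ (by positivity)]
  have h2 : c₀ * (180000 * S * c₁ * (c₀ / (8 * S) + 4 * (2 * q + 1))) =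
      22500 * (c₁ * c₀ ^ 2) + 720000 * (c₀ * S * c₁) * (2 * q + 1) := by
    field_simp; ring
  rw [h2]
  have h3 : 0 ≤ 720000 * (c₀ * S * c₁) * (2 * (q : ℝ) + 1) := by positivity
  have h4 : 0 < c₁ * c₀ ^ 2 := by positivity
  linarith

theorem cellDiamSq_le (hS : 0 < S) (hc₀ : 0 < c₀) (hc₁ : c₀ < c₁) :
    420 * cellDiamSq q S c₀ c₁ ≤ 1 := by
  have h1 := cellDiamSq_mul_le (q := q) hS hc₀ hc₁
  have h2 := cellDiamSq_pos (q := q) hS hc₀ hc₁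
  nlinarith

/-- The bound for one cell of the covering. The distinguished point of the cell is `v`. -/
theorem measure_cell_le {Ω : Type*} [MeasurableSpace Ω] {P : Measure Ω} (hq : 0 < q)
    (hS : 0 < S) (hc₀ : 0 < c₀) (hc₁ : c₀ < c₁) {δ : ℝ} (hδ : 0 < δ)
    (hδd : q * δ ^ 2 = cellDiamSq q S c₀ c₁) {K : Set (EuclideanSpace ℝ (Fin q))} {z : Fin q → ℝ}
    (hK : ∀ u ∈ K, ∀ i, z i ≤ u i ∧ u i < z i + δ) {v : EuclideanSpace ℝ (Fin q)} (hv : v ∈ K)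
    {V : EuclideanSpace ℝ (Fin q) → Ω → ℝ} {φ : EuclideanSpace ℝ (Fin q) → ℝ}
    (hlow : ∀ u ∈ K, c₀ * ‖u‖ ^ 2 ≤ φ u)
    (hφ : ∀ u ∈ K, ∀ w ∈ K, φ w ≤ (1 + 1 / 20) * φ u + (1 + 20) * (c₁ * ‖u - w‖ ^ 2))
    (htail₀ : ∀ u ∈ K, 0 < φ u → ∀ x, 0 ≤ x →
      P {ω | x ≤ V u ω} ≤ ENNReal.ofReal (Real.exp (-(x ^ 2 / (2 * S * φ u)))))
    (htail : ∀ u ∈ K, ∀ w ∈ K, ∀ r, 0 < r → ‖u - w‖ ^ 2 ≤ r → ∀ x, 0 ≤ x →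
      P {ω | x ≤ V u ω - V w ω} ≤ ENNReal.ofReal (Real.exp (-(x ^ 2 / (2 * S * c₁ * r)))))
    (hcont : ∀ᵐ ω ∂P, ContinuousOn (fun u => V u ω) K) {R : ℝ} (hR : 1 < R) :
    P {ω | ∃ u ∈ K, R ≤ ‖u‖ ∧ φ u ≤ 2 * V u ω} ≤
      ENNReal.ofReal ((1 + 2 ^ (q + 1)) * Real.exp (-(c₀ / (16 * S)) * R ^ 2)) *
        ENNReal.ofReal (Real.exp (-(c₀ / (80 * S)) * ‖v‖ ^ 2)) := by
  have hc₁0 : 0 < c₁ := hc₀.trans hc₁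
  have hd1 := cellDiamSq_mul_le (q := q) hS hc₀ hc₁
  have hd2 := cellDiamSq_le (q := q) hS hc₀ hc₁
  have hd0 := cellDiamSq_pos (q := q) hS hc₀ hc₁
  set d := cellDiamSq q S c₀ c₁ with hd
  by_cases hex : ∃ u ∈ K, R ≤ ‖u‖
  swap
  · have : {ω | ∃ u ∈ K, R ≤ ‖u‖ ∧ φ u ≤ 2 * V u ω} = ∅ := by
      ext ω
      simp only [Set.mem_ofPred_eq, Set.mem_empty_iff_false, iff_false]
      rintro ⟨u, hu, hu', -⟩
      exact hex ⟨u, hu, hu'⟩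
    rw [this, measure_empty]
    exact zero_le
  have hdist : ∀ u ∈ K, ‖u - v‖ ^ 2 ≤ d := by
    intro u hu
    rw [← hδd]
    refine norm_sub_sq_le_of_forall_abs_le fun i => ?_
    have h1 := hK u hu i
    have h2 := hK v hv i
    rw [abs_le]; constructor <;> linarith
  have hle1 : ∀ u ∈ K, ‖u‖ ^ 2 ≤ (1 + 1 / 20) * ‖v‖ ^ 2 + 21 * d := by
    intro u hu
    have h := norm_add_sq_le_weighted (by norm_num : (0 : ℝ) < 1 / 20) v (u - v)
    rw [add_sub_cancel] at h
    have := hdist u hu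
    norm_num at h ⊢
    linarith
  have hle2 : ∀ u ∈ K, ‖v‖ ^ 2 ≤ (1 + 1 / 20) * ‖u‖ ^ 2 + 21 * d := by
    intro u hu
    have h := norm_add_sq_le_weighted (by norm_num : (0 : ℝ) < 1 / 20) u (v - u)
    rw [add_sub_cancel, norm_sub_rev v u] at h
    have := hdist u hu
    norm_num at h ⊢
    linarith
  obtain ⟨u₀, hu₀, hRu₀⟩ := hex
  have hR2 : 1 ≤ R ^ 2 := by nlinarith
  -- Since 21d ≤ 1/20 ≤ R²/20, this is R² ≤ (21/20)‖v‖² + R²/20 rearranged.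
  have hvR : R ^ 2 ≤ 21 / 19 * ‖v‖ ^ 2 := by
    have h1 := hle1 u₀ hu₀
    have h2 : R ^ 2 ≤ ‖u₀‖ ^ 2 := by gcongr
    linarith
  have hvlow := hlow v hv
  have hv0 : 0 < ‖v‖ ^ 2 := by linarith
  have hφv : 0 < φ v := lt_of_lt_of_le (by positivity) hvlow
  -- The oscillation to be excluded is φ(u)/40 ≥ c₀‖u‖²/40; a threshold linear in ‖v‖ lies below it
  -- and already makes `A` quadratic in ‖v‖.
  set x : ℝ := c₀ * ‖v‖ / 50 with hx
  have hx0 : 0 ≤ x := by positivity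
  set A : ℝ := x ^ 2 / (36 * (2 * S * c₁) * (q * δ ^ 2)) with hA
  -- `cellDiamSq` is tuned for this identity (180000 = 36 · 2 · 50²): the term c₀/(8S) matches the
  -- ideal pointwise exponent, and 4(2q+1) meets the chaining requirement because ‖v‖² ≥ 1/4.
  have hAval : A = ‖v‖ ^ 2 * (c₀ / (8 * S) + 4 * (2 * q + 1)) := by
    rw [hA, hδd, hd, cellDiamSq, hx]
    field_simp
    ring
  have hAq : 2 * (q : ℝ) + 1 ≤ A := by
    rw [hAval]
    have h1 : 0 < c₀ / (8 * S) := by positivity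
    have h2 : (0 : ℝ) ≤ q := Nat.cast_nonneg q
    have h3 : 1 / 4 ≤ ‖v‖ ^ 2 := by linarith
    nlinarith
  have hchain := measure_exists_increment_gt_le hδ hq hK hv hcont
    (by positivity : 0 < 2 * S * c₁) htail hx0 hA hAq
  -- As φ(v) ≤ (11/10)φ(u), failure at `v` gives V(v) < (19/40)φ(u), whereas V(u) ≥ (20/40)φ(u); so
  -- V increases by more than φ(u)/40.
  have hpt := htail₀ v hv hφv (19 / 44 * φ v) (by positivity)
  have hsub : {ω | ∃ u ∈ K, R ≤ ‖u‖ ∧ φ u ≤ 2 * V u ω} ⊆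
      {ω | 19 / 44 * φ v ≤ V v ω} ∪ {ω | ∃ u ∈ K, x < V u ω - V v ω} := by
    rintro ω ⟨u, hu, hRu, hVu⟩
    by_cases h : 19 / 44 * φ v ≤ V v ω
    · exact Or.inl h
    refine Or.inr ⟨u, hu, ?_⟩
    rw [not_le] at h
    have hu1 : 1 ≤ ‖u‖ := hR.le.trans hRu
    have hu2 : 1 ≤ ‖u‖ ^ 2 := by nlinarith
    have h1 := hφ u hu v hv
    have h2 := hlow u hu
    have h3 : c₁ * ‖u - v‖ ^ 2 ≤ c₁ * d := by gcongr; exact hdist u hu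
    have h4 : c₀ ≤ φ u := by nlinarith
    have h5 : φ v ≤ 11 / 10 * φ u := by linarith
    have h6 : φ u / 40 < V u ω - V v ω := by linarith
    have h7 : ‖v‖ ^ 2 ≤ (21 / 20 * ‖u‖) ^ 2 := by
      have := hle2 u hu
      rw [mul_pow]
      linarith
    have h8 : ‖v‖ ≤ 21 / 20 * ‖u‖ := le_of_sq_le_sq h7 (by positivity)
    have h9 : ‖v‖ / 50 ≤ ‖u‖ ^ 2 / 40 := by nlinarith
    have h10 : c₀ * (‖v‖ / 50) ≤ c₀ * (‖u‖ ^ 2 / 40) := by gcongr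
    rw [hx]
    linarith
  -- The budget is (1/16)(21/19) + 1/80 < 23/250; the two tails supply 361/3872 and 1/8, both above
  -- 23/250.
  have hkey : ∀ y : ℝ, 23 / 250 * (c₀ / S * ‖v‖ ^ 2) ≤ y →
      Real.exp (-y) ≤ Real.exp (-(c₀ / (16 * S)) * R ^ 2) *
        Real.exp (-(c₀ / (80 * S)) * ‖v‖ ^ 2) := by
    intro y hy
    rw [← Real.exp_add]
    refine Real.exp_le_exp.2 ?_
    have h1 : c₀ / (16 * S) * R ^ 2 ≤ c₀ / (16 * S) * (21 / 19 * ‖v‖ ^ 2) := by gcongr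
    have h2 : c₀ / (16 * S) * (21 / 19 * ‖v‖ ^ 2) = 21 / 304 * (c₀ / S * ‖v‖ ^ 2) := by
      field_simp; ring
    have h3 : c₀ / (80 * S) * ‖v‖ ^ 2 = 1 / 80 * (c₀ / S * ‖v‖ ^ 2) := by
      field_simp
    have h4 : 0 ≤ c₀ / S * ‖v‖ ^ 2 := by positivity
    linarith
  have hb1 := hkey ((19 / 44 * φ v) ^ 2 / (2 * S * φ v)) (by
    have h1 : (19 / 44 * φ v) ^ 2 / (2 * S * φ v) = 361 / 3872 * (φ v / S) := by
      field_simp; norm_num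
    rw [h1]
    have h2 : c₀ / S * ‖v‖ ^ 2 ≤ φ v / S := by
      rw [div_mul_eq_mul_div]; gcongr
    have h3 : 0 ≤ c₀ / S * ‖v‖ ^ 2 := by positivity
    linarith)
  have hb2 := hkey A (by
    rw [hAval]
    have h1 : ‖v‖ ^ 2 * (c₀ / (8 * S) + 4 * (2 * q + 1)) =
        1 / 8 * (c₀ / S * ‖v‖ ^ 2) + 4 * (‖v‖ ^ 2 * (2 * q + 1)) := by
      field_simp
    rw [h1]
    have h2 : 0 ≤ ‖v‖ ^ 2 * (2 * (q : ℝ) + 1) := by positivity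
    have h3 : 0 ≤ c₀ / S * ‖v‖ ^ 2 := by positivity
    linarith)
  calc _ ≤ P {ω | 19 / 44 * φ v ≤ V v ω} + P {ω | ∃ u ∈ K, x < V u ω - V v ω} :=
        (measure_mono hsub).trans (measure_union_le _ _)
    _ ≤ ENNReal.ofReal (Real.exp (-((19 / 44 * φ v) ^ 2 / (2 * S * φ v)))) +
        ENNReal.ofReal (2 ^ (q + 1) * Real.exp (-A)) := add_le_add hpt hchain
    _ ≤ _ := by
        rw [← ENNReal.ofReal_add (by positivity) (by positivity),
          ← ENNReal.ofReal_mul (by positivity)]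
        refine ENNReal.ofReal_le_ofReal ?_
        have h1 := mul_le_mul_of_nonneg_left hb2 (by positivity : (0 : ℝ) ≤ 2 ^ (q + 1))
        linarith

/-- A large deviation bound for a sub-Gaussian field `V` on a subset of `ℝ^q`, compared with a
quadratic functional `φ`. The constant depends only on the dimension and the metric constants. -/
theorem exists_measure_exists_le_exp (hq : 0 < q) (hS : 0 < S) (hc₀ : 0 < c₀) (hc₁ : c₀ < c₁) :
    ∃ B : ℝ, 0 < B ∧ ∀ {Ω : Type*} [MeasurableSpace Ω] (P : Measure Ω)
      (U : Set (EuclideanSpace ℝ (Fin q)))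
      (V : EuclideanSpace ℝ (Fin q) → Ω → ℝ) (φ : EuclideanSpace ℝ (Fin q) → ℝ),
      (∀ u ∈ U, c₀ * ‖u‖ ^ 2 ≤ φ u) →
      (∀ u ∈ U, ∀ w ∈ U, φ w ≤ (1 + 1 / 20) * φ u + (1 + 20) * (c₁ * ‖u - w‖ ^ 2)) →
      (∀ u ∈ U, 0 < φ u → ∀ x, 0 ≤ x →
        P {ω | x ≤ V u ω} ≤ ENNReal.ofReal (Real.exp (-(x ^ 2 / (2 * S * φ u))))) →
      (∀ u ∈ U, ∀ w ∈ U, ∀ r, 0 < r → ‖u - w‖ ^ 2 ≤ r → ∀ x, 0 ≤ x →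
        P {ω | x ≤ V u ω - V w ω} ≤ ENNReal.ofReal (Real.exp (-(x ^ 2 / (2 * S * c₁ * r))))) →
      (∀ᵐ ω ∂P, ContinuousOn (fun u => V u ω) U) →
      ∀ R, 1 < R → P {ω | ∃ u ∈ U, R ≤ ‖u‖ ∧ φ u ≤ 2 * V u ω} ≤
        ENNReal.ofReal (B * Real.exp (-(c₀ / (16 * S)) * R ^ 2)) := by
  classical
  have hd0 := cellDiamSq_pos (q := q) hS hc₀ hc₁
  have hq0 : (0 : ℝ) < q := by exact_mod_cast hq
  set δ : ℝ := Real.sqrt (cellDiamSq q S c₀ c₁ / q) with hδdef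
  have hδ : 0 < δ := Real.sqrt_pos.2 (by positivity)
  have hδd : q * δ ^ 2 = cellDiamSq q S c₀ c₁ := by
    rw [hδdef, Real.sq_sqrt (by positivity)]; field_simp
  -- `G` does not depend on the choice of cell points, hence not on `U`; this is what makes the
  -- final constant uniform in T.
  obtain ⟨G, hG0, hG⟩ := exists_tsum_cells_exp_le q (c := c₀ / (80 * S)) (by positivity) hδ
  refine ⟨(1 + 2 ^ (q + 1)) * (G + 1), by positivity, ?_⟩
  intro Ω _ P U V φ hlow hφ htail₀ htail hcont R hR
  set K : (Fin q → ℤ) → Set (EuclideanSpace ℝ (Fin q)) :=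
    fun j => {u | u ∈ U ∧ ∀ i, δ * j i ≤ u i ∧ u i < δ * j i + δ} with hK
  have hv : ∀ j, ∃ v : EuclideanSpace ℝ (Fin q), ((K j).Nonempty → v ∈ K j) ∧
      ∀ i, δ * j i ≤ v i ∧ v i ≤ δ * j i + δ := by
    intro j
    by_cases hj : (K j).Nonempty
    · obtain ⟨v, hv⟩ := hj
      exact ⟨v, fun _ => hv, fun i => ⟨(hv.2 i).1, (hv.2 i).2.le⟩⟩
    -- A cell that misses `U` gets its corner, so that the lattice sum runs over all indices.
    · refine ⟨WithLp.toLp 2 fun i => δ * j i, fun h => absurd h hj, fun i => ⟨le_rfl, ?_⟩⟩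
      simp only
      linarith
  choose v hvK hvc using hv
  have hcell : ∀ j, P {ω | ∃ u ∈ K j, R ≤ ‖u‖ ∧ φ u ≤ 2 * V u ω} ≤
      ENNReal.ofReal ((1 + 2 ^ (q + 1)) * Real.exp (-(c₀ / (16 * S)) * R ^ 2)) *
        ENNReal.ofReal (Real.exp (-(c₀ / (80 * S)) * ‖v j‖ ^ 2)) := by
    intro j
    by_cases hj : (K j).Nonempty
    · refine measure_cell_le hq hS hc₀ hc₁ hδ hδd (z := fun i => δ * j i)
        (fun u hu i => hu.2 i) (hvK j hj) (fun u hu => hlow u hu.1)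
        (fun u hu w hw => hφ u hu.1 w hw.1) (fun u hu => htail₀ u hu.1)
        (fun u hu w hw => htail u hu.1 w hw.1) ?_ hR
      filter_upwards [hcont] with ω hω
      exact hω.mono fun u hu => hu.1
    · have : {ω | ∃ u ∈ K j, R ≤ ‖u‖ ∧ φ u ≤ 2 * V u ω} = ∅ := by
        ext ω
        simp only [Set.mem_ofPred_eq, Set.mem_empty_iff_false, iff_false]
        rintro ⟨u, hu, -⟩
        exact hj ⟨u, hu⟩
      rw [this, measure_empty]
      exact zero_le
  have hsub : {ω | ∃ u ∈ U, R ≤ ‖u‖ ∧ φ u ≤ 2 * V u ω} ⊆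
      ⋃ j, {ω | ∃ u ∈ K j, R ≤ ‖u‖ ∧ φ u ≤ 2 * V u ω} := by
    rintro ω ⟨u, hu, h1, h2⟩
    refine Set.mem_iUnion.2 ⟨fun i => ⌊u i / δ⌋, u, ⟨hu, fun i => ?_⟩, h1, h2⟩
    have h3 := Int.floor_le (u i / δ)
    have h4 := Int.lt_floor_add_one (u i / δ)
    rw [le_div_iff₀ hδ] at h3
    rw [div_lt_iff₀ hδ] at h4
    constructor <;> linarith
  calc _ ≤ ∑' j, P {ω | ∃ u ∈ K j, R ≤ ‖u‖ ∧ φ u ≤ 2 * V u ω} :=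
        (measure_mono hsub).trans (measure_iUnion_le _)
    _ ≤ ∑' j, ENNReal.ofReal ((1 + 2 ^ (q + 1)) * Real.exp (-(c₀ / (16 * S)) * R ^ 2)) *
        ENNReal.ofReal (Real.exp (-(c₀ / (80 * S)) * ‖v j‖ ^ 2)) := ENNReal.tsum_le_tsum hcell
    _ ≤ ENNReal.ofReal ((1 + 2 ^ (q + 1)) * Real.exp (-(c₀ / (16 * S)) * R ^ 2)) *
        ENNReal.ofReal G := by
        rw [ENNReal.tsum_mul_left]
        gcongr
        exact hG v hvc
    _ ≤ _ := by
        rw [← ENNReal.ofReal_mul (by positivity)]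
        refine ENNReal.ofReal_le_ofReal ?_
        have : 0 ≤ (1 + 2 ^ (q + 1)) * Real.exp (-(c₀ / (16 * S)) * R ^ 2) := by positivity
        linarith

end LargeDeviation

/-! ### Quadratic inequalities for integrals over [0, T] -/

section IntervalIntegrals

variable {T : ℝ} {g h : ℝ → ℝ}

theorem ContinuousOn.intervalIntegrable_zero_of_pos (hT : 0 < T)
    (hg : ContinuousOn g (Set.Icc 0 T)) : IntervalIntegrable g volume 0 T :=
  ContinuousOn.intervalIntegrable (by rwa [Set.uIcc_of_le hT.le])

theorem integral_add_mul_sq (hT : 0 < T) (hg : ContinuousOn g (Set.Icc 0 T))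
    (hh : ContinuousOn h (Set.Icc 0 T)) (l : ℝ) :
    ∫ t in (0 : ℝ)..T, (g t + l * h t) ^ 2 =
      (∫ t in (0 : ℝ)..T, h t ^ 2) * (l * l) + 2 * (∫ t in (0 : ℝ)..T, g t * h t) * l +
        ∫ t in (0 : ℝ)..T, g t ^ 2 := by
  have h1 : IntervalIntegrable (fun t => g t ^ 2) volume 0 T :=
    (hg.pow 2).intervalIntegrable_zero_of_pos hT
  have h2 : IntervalIntegrable (fun t => h t ^ 2) volume 0 T :=
    (hh.pow 2).intervalIntegrable_zero_of_pos hT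
  have h3 : IntervalIntegrable (fun t => g t * h t) volume 0 T :=
    (hg.mul hh).intervalIntegrable_zero_of_pos hT
  have heq : ∀ t, (g t + l * h t) ^ 2 = (l * l) * h t ^ 2 + (2 * l) * (g t * h t) + g t ^ 2 :=
    fun t => by ring
  simp_rw [heq]
  rw [intervalIntegral.integral_add ((h2.const_mul _).add (h3.const_mul _)) h1,
    intervalIntegral.integral_add (h2.const_mul _) (h3.const_mul _),
    intervalIntegral.integral_const_mul, intervalIntegral.integral_const_mul]
  ring

/-- Cauchy–Schwarz, from the discriminant of the nonnegative quadratic l ↦ ∫(g + lh)². -/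
theorem sq_integral_mul_le (hT : 0 < T) (hg : ContinuousOn g (Set.Icc 0 T))
    (hh : ContinuousOn h (Set.Icc 0 T)) :
    (∫ t in (0 : ℝ)..T, g t * h t) ^ 2 ≤
      (∫ t in (0 : ℝ)..T, g t ^ 2) * ∫ t in (0 : ℝ)..T, h t ^ 2 := by
  have h1 := discrim_le_zero (a := ∫ t in (0 : ℝ)..T, h t ^ 2)
    (b := 2 * ∫ t in (0 : ℝ)..T, g t * h t) (c := ∫ t in (0 : ℝ)..T, g t ^ 2) fun l => by
      rw [← integral_add_mul_sq hT hg hh]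
      exact intervalIntegral.integral_nonneg hT.le fun t _ => sq_nonneg _
  rw [discrim] at h1
  linarith

theorem integral_sq_le_weighted (hT : 0 < T) (hg : ContinuousOn g (Set.Icc 0 T))
    (hh : ContinuousOn h (Set.Icc 0 T)) :
    ∫ t in (0 : ℝ)..T, h t ^ 2 ≤ (1 + 1 / 20) * (∫ t in (0 : ℝ)..T, g t ^ 2) +
      (1 + 20) * ∫ t in (0 : ℝ)..T, (g t - h t) ^ 2 := by
  have h1 : IntervalIntegrable (fun t => g t ^ 2) volume 0 T :=
    (hg.pow 2).intervalIntegrable_zero_of_pos hT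
  have h2 : IntervalIntegrable (fun t => h t ^ 2) volume 0 T :=
    (hh.pow 2).intervalIntegrable_zero_of_pos hT
  have h3 : IntervalIntegrable (fun t => (g t - h t) ^ 2) volume 0 T :=
    ((hg.sub hh).pow 2).intervalIntegrable_zero_of_pos hT
  rw [← intervalIntegral.integral_const_mul, ← intervalIntegral.integral_const_mul,
    ← intervalIntegral.integral_add (h1.const_mul _) (h3.const_mul _)]
  refine intervalIntegral.integral_mono_on hT.le h2 ((h1.const_mul _).add (h3.const_mul _))
    fun t _ => ?_
  nlinarith [sq_nonneg (1 / 20 * g t + (g t - h t))]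

end IntervalIntegrals

/-! ### From the regression model to the large deviation bound -/

section Regression

variable {q : ℕ} {Θ : Set (EuclideanSpace ℝ (Fin q))} {a : ℝ → EuclideanSpace ℝ (Fin q) → ℝ}
  {θ : EuclideanSpace ℝ (Fin q)}

theorem IsNormalization.pos {s : ℝ → Fin q → ℝ} {T₀ : ℝ} (hs : IsNormalization Θ a s T₀)
    (hθ : θ ∈ Θ) {T : ℝ} (hT : T₀ < T) (i : Fin q) : 0 < s T i := by
  obtain ⟨cl, cu, hc, h⟩ := hs
  by_contra hneg
  have h1 := (h T hT θ hθ i).1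
  have h2 : (s T i)⁻¹ * gradientNorm a T θ i ≤ 0 :=
    mul_nonpos_of_nonpos_of_nonneg (inv_nonpos.2 (not_lt.1 hneg)) (Real.sqrt_nonneg _)
  linarith [(hc i).1]

theorem regressionIncrement_diagAct {s : Fin q → ℝ} (hs : ∀ i, 0 < s i) (t : ℝ)
    (τ : EuclideanSpace ℝ (Fin q)) :
    regressionIncrement a θ s t (diagAct s (τ - θ)) = a t τ - a t θ := by
  have : θ + diagAct (fun i => (s i)⁻¹) (diagAct s (τ - θ)) = τ := by
    ext i
    have := (hs i).ne'
    simp [diagAct, this]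
  rw [regressionIncrement, this]

theorem diagAct_zero (s : Fin q → ℝ) : diagAct s 0 = 0 := by
  ext i; simp [diagAct]

theorem regressionIncrement_zero (s : Fin q → ℝ) (t : ℝ) : regressionIncrement a θ s t 0 = 0 := by
  simp [regressionIncrement, diagAct_zero]

theorem regressionDist_zero_right (s : Fin q → ℝ) (T : ℝ) (u : EuclideanSpace ℝ (Fin q)) :
    regressionDist a θ s T u 0 = ∫ t in (0 : ℝ)..T, regressionIncrement a θ s t u ^ 2 := by
  simp [regressionDist, regressionIncrement_zero]

theorem zero_mem_normalizedParameterSet (hθ : θ ∈ Θ) (s : Fin q → ℝ) :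
    (0 : EuclideanSpace ℝ (Fin q)) ∈ normalizedParameterSet Θ θ s :=
  ⟨θ, subset_closure hθ, by simp [diagAct_zero]⟩

theorem IsRegressionFunction.continuousOn_left (ha : IsRegressionFunction Θ a)
    {τ : EuclideanSpace ℝ (Fin q)} (hτ : τ ∈ closure Θ) (T : ℝ) :
    ContinuousOn (fun t => a t τ) (Set.Icc 0 T) :=
  ha.continuousOn.comp (f := fun t : ℝ => (t, τ)) (by fun_prop) fun _ ht => ⟨ht.1, hτ⟩

theorem IsRegressionFunction.continuousOn_increment (ha : IsRegressionFunction Θ a)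
    (hθ : θ ∈ Θ) {s : Fin q → ℝ} (hs : ∀ i, 0 < s i) {u : EuclideanSpace ℝ (Fin q)}
    (hu : u ∈ normalizedParameterSet Θ θ s) (T : ℝ) :
    ContinuousOn (fun t => regressionIncrement a θ s t u) (Set.Icc 0 T) := by
  obtain ⟨τ, hτ, rfl⟩ := hu
  simp only [regressionIncrement_diagAct hs]
  exact (ha.continuousOn_left hτ T).sub (ha.continuousOn_left (subset_closure hθ) T)

/-- The basic inequality for a minimizer of the least squares functional. -/
theorem regressionDist_le_of_leastSquares_le {Ω : Type*} {ε : ℝ → Ω → ℝ} {ω : Ω}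
    (ha : IsRegressionFunction Θ a) (hθ : θ ∈ Θ) {s : Fin q → ℝ} (hs : ∀ i, 0 < s i) {T : ℝ}
    (hT : 0 < T) (hω : Continuous fun t => ε t ω) {τ : EuclideanSpace ℝ (Fin q)}
    (hτ : τ ∈ closure Θ)
    (hle : leastSquares a (observation a θ ε) T τ ω ≤
      leastSquares a (observation a θ ε) T θ ω) :
    regressionDist a θ s T (diagAct s (τ - θ)) 0 ≤
      2 * ∫ t in (0 : ℝ)..T, ε t ω * regressionIncrement a θ s t (diagAct s (τ - θ)) := by
  rw [regressionDist_zero_right]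
  simp only [regressionIncrement_diagAct hs]
  have h1 : leastSquares a (observation a θ ε) T τ ω =
      ∫ t in (0 : ℝ)..T, (ε t ω + (-1) * (a t τ - a t θ)) ^ 2 := by
    refine intervalIntegral.integral_congr fun t _ => ?_
    simp only [observation]
    ring
  have h2 : leastSquares a (observation a θ ε) T θ ω = ∫ t in (0 : ℝ)..T, ε t ω ^ 2 := by
    refine intervalIntegral.integral_congr fun t _ => ?_
    simp only [observation]
    ring
  rw [h1, h2, integral_add_mul_sq (h := fun t => a t τ - a t θ) hT hω.continuousOn
    ((ha.continuousOn_left hτ T).sub (ha.continuousOn_left (subset_closure hθ) T))] at hle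
  linarith

/-- The exponential bound for the least squares estimator, with an explicit exponent, when the
spectral density is bounded by `F`. -/
theorem exists_lseExponentialBound {Ω : Type*} [MeasurableSpace Ω] {P : Measure Ω}
    (hq : 0 < q) (hθ : θ ∈ Θ) (ha : IsRegressionFunction Θ a) {ε : ℝ → Ω → ℝ}
    (hN1 : IsContinuousCentredNoise P ε) (hN2 : IsJointlyStrictlySubGaussian P ε) {f : ℝ → ℝ}
    (hN3 : HasBoundedSpectralDensity P ε f) {T₀ : ℝ} (hT₀ : 0 ≤ T₀) {s : ℝ → Fin q → ℝ}
    (hs : IsNormalization Θ a s T₀) {c₀ c₁ : ℝ} (hc₀ : 0 < c₀) (hc₁ : c₀ < c₁)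
    (hR3 : IsBiLipschitzRegression Θ a θ s T₀ c₀ c₁) {F : ℝ} (hF0 : 0 < F) (hF : ∀ x, f x ≤ F) :
    ∃ B : ℝ, 0 < B ∧
      LSEExponentialBound P Θ a θ ε s T₀ 1 B (c₀ / (16 * (2 * Real.pi * F))) := by
  have hpi := Real.pi_pos
  have hc₁0 : 0 < c₁ := hc₀.trans hc₁
  obtain ⟨B, hB0, hB⟩ := exists_measure_exists_le_exp hq
    (by positivity : 0 < 2 * Real.pi * F) hc₀ hc₁
  refine ⟨B, hB0, fun T hT R hR θT hθT => ?_⟩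
  have hTpos : 0 < T := hT₀.trans_lt hT
  have hsT : ∀ i, 0 < s T i := hs.pos hθ hT
  set U := normalizedParameterSet Θ θ (s T) with hU
  have h0U : (0 : EuclideanSpace ℝ (Fin q)) ∈ U := zero_mem_normalizedParameterSet hθ _
  set D : EuclideanSpace ℝ (Fin q) → ℝ → ℝ := fun u t => regressionIncrement a θ (s T) t u with hD
  have hDc : ∀ u ∈ U, ContinuousOn (D u) (Set.Icc 0 T) :=
    fun u hu => ha.continuousOn_increment hθ hsT hu T
  have hdist : ∀ u ∈ U, ∀ w ∈ U, ∫ t in (0 : ℝ)..T, (D u t - D w t) ^ 2 ≤ c₁ * ‖u - w‖ ^ 2 :=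
    fun u hu w hw => (hR3 T hT u hu w hw).2
  have hVsub : ∀ ω, (Continuous fun t => ε t ω) → ∀ u ∈ U, ∀ w ∈ U,
      (∫ t in (0 : ℝ)..T, ε t ω * D u t) - ∫ t in (0 : ℝ)..T, ε t ω * D w t =
        ∫ t in (0 : ℝ)..T, ε t ω * (D u t - D w t) := by
    intro ω hω u hu w hw
    have hint : ∀ u ∈ U, IntervalIntegrable (fun t => ε t ω * D u t) volume 0 T := fun u hu =>
      (hω.continuousOn.mul (hDc u hu)).intervalIntegrable_zero_of_pos hTpos
    rw [← intervalIntegral.integral_sub (hint u hu) (hint w hw)]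
    refine intervalIntegral.integral_congr fun t _ => ?_
    ring
  have hmain := hB P U (fun u ω => ∫ t in (0 : ℝ)..T, ε t ω * D u t)
    (fun u => regressionDist a θ (s T) T u 0) ?_ ?_ ?_ ?_ ?_ R hR
  · refine ENNReal.toReal_le_of_le_ofReal (by positivity) (le_trans ?_ hmain)
    refine measure_mono_ae ?_
    filter_upwards [hN1.ae_continuous, hθT.mem_closure, hθT.minimizes] with ω hω hmem hmin hRω
    exact ⟨_, ⟨θT ω, hmem, rfl⟩, hRω,
      regressionDist_le_of_leastSquares_le ha hθ hsT hTpos hω hmem (hmin (subset_closure hθ))⟩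
  · intro u hu
    have := (hR3 T hT u hu 0 h0U).1
    rwa [sub_zero] at this
  · intro u hu w hw
    simp only [regressionDist_zero_right]
    have h1 := integral_sq_le_weighted hTpos (hDc u hu) (hDc w hw)
    have h2 := hdist u hu w hw
    linarith
  · intro u hu hpos x hx
    exact measure_noise_integral_ge_le hTpos hN1 hN2 hN3 hF0 hF (hDc u hu) hpos
      (regressionDist_zero_right (s T) T u).ge hx
  · intro u hu w hw r hr hle x hx
    -- The proxy is `c₁ * r` rather than c₁‖u - w‖², which keeps it positive when `u = w`.
    rw [mul_assoc (2 * (2 * Real.pi * F))]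
    refine le_trans (measure_mono_ae ?_) (measure_noise_integral_ge_le hTpos hN1 hN2 hN3 hF0 hF
      ((hDc u hu).sub (hDc w hw)) (by positivity : 0 < c₁ * r)
      ((hdist u hu w hw).trans (by gcongr)) hx)
    filter_upwards [hN1.ae_continuous] with ω hω hxω
    exact hxω.trans_eq (hVsub ω hω u hu w hw)
  · filter_upwards [hN1.ae_continuous] with ω hω
    -- By Cauchy–Schwarz and the upper bound c₁, V is Lipschitz on `U` with constant √C; this
    -- supplies the path continuity used in chaining.
    set C : ℝ := (∫ t in (0 : ℝ)..T, ε t ω ^ 2) * c₁ with hC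
    have hI0 : 0 ≤ ∫ t in (0 : ℝ)..T, ε t ω ^ 2 :=
      intervalIntegral.integral_nonneg hTpos.le fun t _ => sq_nonneg _
    have hC0 : 0 ≤ C := by positivity
    refine (LipschitzOnWith.of_dist_le_mul (K := (Real.sqrt C).toNNReal)
      fun u hu w hw => ?_).continuousOn
    rw [Real.dist_eq, hVsub ω hω u hu w hw, dist_eq_norm, Real.coe_toNNReal _ (Real.sqrt_nonneg C)]
    refine abs_le_of_sq_le_sq ?_ (by positivity)
    rw [mul_pow, Real.sq_sqrt hC0, hC, mul_assoc]
    refine (sq_integral_mul_le hTpos hω.continuousOn ((hDc u hu).sub (hDc w hw))).trans ?_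
    exact mul_le_mul_of_nonneg_left (hdist u hu w hw) hI0

end Regression

theorem corollary2 {Ω : Type*} [MeasurableSpace Ω] (P : Measure Ω) [IsProbabilityMeasure P]
    (q : ℕ) (Θ : Set (EuclideanSpace ℝ (Fin q))) (hΘ_open : IsOpen Θ)
    (hΘ_bdd : Bornology.IsBounded Θ) (hΘ_conv : Convex ℝ Θ)
    (θ : EuclideanSpace ℝ (Fin q)) (hθ : θ ∈ Θ)
    (a : ℝ → EuclideanSpace ℝ (Fin q) → ℝ) (ha : IsRegressionFunction Θ a)
    (ε : ℝ → Ω → ℝ) (hN1 : IsContinuousCentredNoise P ε)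
    (hN2 : IsJointlyStrictlySubGaussian P ε)
    (f : ℝ → ℝ) (hN3 : HasBoundedSpectralDensity P ε f)
    (T₀ : ℝ) (hT₀ : 0 ≤ T₀)
    (s : ℝ → Fin q → ℝ) (hs : IsNormalization Θ a s T₀)
    (c₀ c₁ : ℝ) (hc₀ : 0 < c₀) (hc₁ : c₀ < c₁)
    (hR3 : IsBiLipschitzRegression Θ a θ s T₀ c₀ c₁) :
    ∃ R₀ : ℝ, 0 < R₀ ∧
      (∃ B b : ℝ, 0 < B ∧ 0 < b ∧ LSEExponentialBound P Θ a θ ε s T₀ R₀ B b) ∧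
      ∀ β : ℝ, 0 < β → ∃ B b : ℝ, 0 < B ∧ 0 < b ∧
        c₀ / (16 * Real.pi * (⨆ x, f x) * (1 + (q : ℝ))) - β ≤ b ∧
        LSEExponentialBound P Θ a θ ε s T₀ R₀ B b := by
  have hpi := Real.pi_pos
  have hfle : ∀ x, f x ≤ ⨆ x, f x := le_ciSup hN3.density_bddAbove
  have hf0 : 0 ≤ ⨆ x, f x := (hN3.density_nonneg 0).trans (hfle 0)
  suffices h : ∃ B b : ℝ, 0 < B ∧ 0 < b ∧
      c₀ / (16 * Real.pi * (⨆ x, f x) * (1 + (q : ℝ))) ≤ b ∧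
      LSEExponentialBound P Θ a θ ε s T₀ 1 B b by
    obtain ⟨B, b, hB, hb, hle, h⟩ := h
    exact ⟨1, one_pos, ⟨B, b, hB, hb, h⟩, fun β hβ => ⟨B, b, hB, hb, by linarith, h⟩⟩
  rcases Nat.eq_zero_or_pos q with rfl | hq
  -- In dimension 0 the norm vanishes and the event is empty, so any `b` works.
  · refine ⟨1, |c₀ / (16 * Real.pi * (⨆ x, f x) * (1 + ((0 : ℕ) : ℝ)))| + 1, one_pos,
      by positivity, (le_abs_self _).trans (by linarith), fun T _ R hR θT _ => ?_⟩
    have : {ω | R ≤ ‖diagAct (s T) (θT ω - θ)‖} = ∅ := by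
      ext ω
      simp only [Set.mem_ofPred_eq, Set.mem_empty_iff_false, iff_false, not_le]
      rw [Subsingleton.elim (diagAct (s T) (θT ω - θ)) 0, norm_zero]
      linarith
    rw [this, measureReal_empty]
    positivity
  · have hq1 : (1 : ℝ) ≤ q := by exact_mod_cast hq
    rcases hf0.eq_or_lt with hzero | hpos
    -- When sup f = 0 any positive `F` bounds `f`, and 1 is taken; the required lower bound on `b`
    -- is c₀/0 = 0.
    · obtain ⟨B, hB, h⟩ := exists_lseExponentialBound hq hθ ha hN1 hN2 hN3 hT₀ hs hc₀ hc₁ hR3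
        one_pos (fun x => (hfle x).trans (by rw [← hzero]; exact zero_le_one))
      refine ⟨B, _, hB, by positivity, ?_, h⟩
      rw [← hzero, mul_zero, zero_mul, div_zero]
      positivity
    · obtain ⟨B, hB, h⟩ := exists_lseExponentialBound hq hθ ha hN1 hN2 hN3 hT₀ hs hc₀ hc₁ hR3
        hpos hfle
      refine ⟨B, _, hB, by positivity, ?_, h⟩
      -- What remains is 32πf₀ ≤ 16πf₀(1+q), which is q ≥ 1.
      refine div_le_div_of_nonneg_left hc₀.le (by positivity) ?_
      have : 0 < 16 * Real.pi * (⨆ x, f x) := by positivity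
      nlinarith
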